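/- For a function $g\in L^2(\mathbb{R})$ (complex-valued) and $(x,y)\in\mathbb{R}^2$ put $\rho_{x,y}g(t)=e^{2\pi i y t}g(t-x)$. Let $g(t)=\exp(-\pi t^2)$ and \[ \Lambda=\{(-1,0),(1,0)\}\cup\{(0,\pm\sqrt{2n}) : n=1,2,3,\dots\}\cup\{(\pm\sqrt{2n},0) : n=1,2,3,\dots\}\subset\mathbb{R}^2 . \] Then the Gabor system $\{\rho_{x,y}g : (x,y)\in\Lambda\}$ is complete and minimal in $L^2(\mathbb{R})$; that is, its linear span is dense in $L^2(\mathbb{R})$, and no $\rho_{x,y}g$ with $(x,y)\in\Lambda$ lies in the closed linear span of the functions $\rho_{x',y'}g$ with $(x',y')\in\Lambda\setminus\{(x,y)\}$. Moreover, identify $\Lambda$ with a subset of $\mathbb{C}$ via $(x,y)\mapsto x+iy$. Then the function $s(z)=(z^2-1)z^{-2}\sin\frac{\pi z^2}{2}$, with its removable singularity at $0$ filled in by $s(0)=-\frac{\pi}{2}$, is entire, and $\Lambda$ is exactly its zero set. Furthermore, let $\mathcal{F}$ be the Fock space of all entire functions $F$ with $\int_{\mathbb{C}}|F(z)|^2e^{-\pi|z|^2}\,dm(z)<\infty$,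 where $m$ is Lebesgue measure on the plane. Then $\Lambda$ is a set of uniqueness of zero excess for $\mathcal{F}$: the only $F\in\mathcal{F}$ vanishing at every point of $\Lambda$ is $F=0$, while for each $\lambda\in\Lambda$ there is a nonzero $F\in\mathcal{F}$ vanishing at every point of $\Lambda\setminus\{\lambda\}$. -/

import Mathlib

open MeasureTheory

namespace GaborGauss

/-- The time-frequency shift `ρ_{x,y} g (t) = e^{2 π i y t} g(t - x)`, where `p = (x, y)`. -/
noncomputable def shift (p : ℝ × ℝ) (g : ℝ → ℂ) : ℝ → ℂ :=
  fun t => Complex.exp (2 * Real.pi * Complex.I * p.2 * t) * g (t - p.1)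

/-- Time-frequency shifts preserve square integrability. -/
theorem memLp_shift {g : ℝ → ℂ} (hg : MemLp g 2 volume) (p : ℝ × ℝ) :
    MemLp (shift p g) 2 volume := by
  have h1 : MemLp (fun t => g (t - p.1)) 2 volume :=
    hg.comp_measurePreserving (measurePreserving_sub_right volume p.1)
  have hc : Continuous fun t : ℝ => Complex.exp (2 * Real.pi * Complex.I * p.2 * t) := by
    fun_prop
  refine h1.of_le (hc.aestronglyMeasurable.mul h1.1) (Filter.Eventually.of_forall fun t => ?_)
  have h2 : (2 * Real.pi * Complex.I * p.2 * t : ℂ)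
      = ((2 * Real.pi * p.2 * t : ℝ) : ℂ) * Complex.I := by
    push_cast
    ring
  simp only [shift]
  rw [norm_mul, h2, Complex.norm_exp_ofReal_mul_I, one_mul]

/-- The Gabor system of `g` over `Λ`, as a family in the complex space `L²(ℝ)` indexed by
the points of `Λ`. -/
noncomputable def gaborSystem (g : ℝ → ℂ) (hg : MemLp g 2 volume) (Λ : Set (ℝ × ℝ)) :
    Λ → Lp ℂ 2 (volume : Measure ℝ) :=
  fun p => (memLp_shift hg p).toLp (shift p g)

/-- A family is complete if its linear span is dense. -/
def IsCompleteSystem {ι H : Type*} [NormedAddCommGroup H] [NormedSpace ℂ H] (v : ι → H) : Prop :=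
  (Submodule.span ℂ (Set.range v)).topologicalClosure = ⊤

/-- A family is minimal if no member lies in the closed linear span of the other members. -/
def IsMinimalSystem {ι H : Type*} [NormedAddCommGroup H] [NormedSpace ℂ H] (v : ι → H) : Prop :=
  ∀ i, v i ∉ (Submodule.span ℂ (v '' {j | j ≠ i})).topologicalClosure

/-- The Gaussian `g(t) = exp(-π t²)`. -/
noncomputable def gaussian : ℝ → ℂ := fun t => (Real.exp (-Real.pi * t ^ 2) : ℂ)

theorem memLp_gaussian : MemLp gaussian 2 volume := by
  have hc : Continuous gaussian := by
    unfold gaussian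
    fun_prop
  rw [memLp_two_iff_integrable_sq_norm hc.aestronglyMeasurable]
  have h := integrable_exp_neg_mul_sq (b := 2 * Real.pi) (by positivity)
  refine h.congr (Filter.Eventually.of_forall fun t => ?_)
  simp only [gaussian, Complex.norm_real, Real.norm_eq_abs, Real.abs_exp]
  rw [← Real.exp_nat_mul]
  congr 1
  push_cast
  ring

/-- The points `(±1, 0)`, `(0, ±√(2n))` and `(±√(2n), 0)`, `n = 1, 2, 3, …`. -/
def crossSet : Set (ℝ × ℝ) :=
  {(-1, 0), (1, 0)} ∪
    {p | ∃ n : ℕ, 1 ≤ n ∧ (p = (0, √(2 * n)) ∨ p = (0, -√(2 * n)))} ∪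
    {p | ∃ n : ℕ, 1 ≤ n ∧ (p = (√(2 * n), 0) ∨ p = (-√(2 * n), 0))}

/-- A subset of the plane `ℝ²` viewed as a subset of `ℂ` via `(x, y) ↦ x + i y`. -/
def toComplexSet (Λ : Set (ℝ × ℝ)) : Set ℂ :=
  (fun p : ℝ × ℝ => (p.1 : ℂ) + Complex.I * p.2) '' Λ

/-- Membership in the Fock space: `F` is entire and `∫ |F(z)|² e^{-π|z|²} dm(z) < ∞`. -/
def MemFock (F : ℂ → ℂ) : Prop :=
  Differentiable ℂ F ∧
    Integrable (fun z : ℂ => ‖F z‖ ^ 2 * Real.exp (-Real.pi * ‖z‖ ^ 2)) volume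

/-- `Z` is a set of uniqueness for the Fock space. -/
def IsFockUniquenessSet (Z : Set ℂ) : Prop :=
  ∀ F : ℂ → ℂ, MemFock F → (∀ z ∈ Z, F z = 0) → ∀ z, F z = 0

/-- A set of uniqueness has zero excess if it fails to be a set of uniqueness on the removal
of any one of its points. -/
def IsFockUniquenessSetOfZeroExcess (Z : Set ℂ) : Prop :=
  IsFockUniquenessSet Z ∧ ∀ a ∈ Z, ¬ IsFockUniquenessSet (Z \ {a})

/-- The function `(z² - 1) z⁻² sin(π z² / 2)`, with its removable singularity at `0` filled in
by the limit value `-π/2`. -/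
noncomputable def sineProduct (z : ℂ) : ℂ :=
  if z = 0 then -(Real.pi / 2 : ℂ)
  else (z ^ 2 - 1) * (z ^ 2)⁻¹ * Complex.sin (Real.pi * z ^ 2 / 2)

end GaborGauss

namespace GaborGauss
open Filter Topology Set

/-! Write `s` for `sineProduct`; it is entire, and its zeros are simple and form Λ.

Uniqueness (`eq_zero_of_growth_of_decay`). Let `F` be entire with `|F| ≤ M exp(π|z|²/2)` and vanish
on Λ; then `F = s q` with `q` entire. In the quarter-plane around each direction `u = ±1, ±i`,
substitute `z = u √w` with `Re w ≥ 0`. There `s` dominates `sin(πw/2)`, of size about `exp(π|Im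
w|/2)` away from its zeros, so `q` is `O(exp(π/2 (|w| - |Im w|)))` (`exists_norm_le_of_mul_sin`).
This exponent vanishes to second order at the imaginary axis, and Phragmén–Lindelöf turns it into
boundedness (`norm_le_of_half_plane`). By Liouville `q` is constant. On the diagonal `|s|` is at
least `exp(π|z|²/2)/4`, whereas `F exp(-π|z|²/2)` tends to 0 there, so `q = 0`. For Fock functions
the growth and the decay come from the reproducing formula.

Zero excess. For `a ∈ Λ`, `s(z)/(z - a)` lies in the Fock space: its weighted square is bounded by
Gaussians in `x ± y` times `1/(1+y²)`.

Completeness. If `f` is orthogonal to the Gabor system, its Bargmann integral vanishes at the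
conjugates of Λ, which form Λ again. The uniqueness argument makes this integral vanish identically;
on the imaginary axis it is the Fourier transform of `f(t) exp(-πt²)`, so `f = 0`.

Minimality. Up to a constant, the Gabor system has the Gram matrix of the normalized Fock kernels
(`inner_gaborSystem_gaussian`), and membership in a closed span depends only on that matrix. The
function `s(z)/(z - a)` is orthogonal to every kernel of the system but one. Surjectivity of the
Bargmann transform is thus never needed. -/

/-! ### Division of entire functions. -/

theorem differentiable_dslope {F : ℂ → ℂ} (hF : Differentiable ℂ F) (a : ℂ) :
    Differentiable ℂ (dslope F a) := by
  rw [← differentiableOn_univ, Complex.differentiableOn_dslope univ_mem]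
  exact hF.differentiableOn

/-- An entire function vanishing at the zeros of an entire function with only simple zeros is
divisible by it. -/
theorem exists_differentiable_mul_eq {F s : ℂ → ℂ} (hF : Differentiable ℂ F)
    (hs : Differentiable ℂ s) (hs' : ∀ a, s a = 0 → deriv s a ≠ 0)
    (h : ∀ a, s a = 0 → F a = 0) : ∃ q : ℂ → ℂ, Differentiable ℂ q ∧ ∀ z, F z = s z * q z := by
  classical
  refine ⟨fun z => if s z = 0 then deriv F z / deriv s z else F z / s z, fun a => ?_, fun z => ?_⟩
  · by_cases ha : s a = 0
    · have hdF := differentiable_dslope hF a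
      have hds := differentiable_dslope hs a
      have hne : dslope s a a ≠ 0 := by rw [dslope_same]; exact hs' a ha
      -- Near a simple zero of `s` the quotient equals the quotient of the divided differences,
      -- whose denominator does not vanish at `a`.
      have hq : DifferentiableAt ℂ (fun z => dslope F a z / dslope s a z) a :=
        (hdF a).div (hds a) hne
      refine hq.congr_of_eventuallyEq ?_
      filter_upwards [hds.continuous.continuousAt.eventually_ne hne] with z hz
      by_cases hza : z = a
      · subst hza
        simp [ha]
      · have h1 := sub_smul_dslope s a z
        have h2 := sub_smul_dslope F a z
        rw [ha, sub_zero, smul_eq_mul] at h1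
        rw [h a ha, sub_zero, smul_eq_mul] at h2
        have h3 : z - a ≠ 0 := sub_ne_zero.2 hza
        rw [if_neg (by rw [← h1]; exact mul_ne_zero h3 hz), ← h1, ← h2, mul_div_mul_left _ _ h3]
    · refine ((hF a).div (hs a) ha).congr_of_eventuallyEq ?_
      filter_upwards [hs.continuous.continuousAt.eventually_ne ha] with z hz
      simp [hz]
  · by_cases hz : s z = 0
    · simp [hz, h z hz]
    · simp [hz, mul_div_cancel₀]

/-! ### Phragmén–Lindelöf estimates. -/

/-- Quadrant form of the Phragmén–Lindelöf principle for functions of exponential type. -/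
theorem norm_le_of_quadrant {f : ℂ → ℂ} {C B K : ℝ} (hd : DiffContOnCl ℂ f (Ioi 0 ×ℂ Ioi 0))
    (hexp : ∀ z : ℂ, 0 < z.re → 0 < z.im → ‖f z‖ ≤ K * Real.exp (B * ‖z‖))
    (hre : ∀ x : ℝ, 0 ≤ x → ‖f x‖ ≤ C) (him : ∀ x : ℝ, 0 ≤ x → ‖f (x * Complex.I)‖ ≤ C)
    {z : ℂ} (hz_re : 0 ≤ z.re) (hz_im : 0 ≤ z.im) : ‖f z‖ ≤ C := by
  refine PhragmenLindelof.quadrant_I hd ⟨1, by norm_num, B, ?_⟩ hre him hz_re hz_im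
  refine Asymptotics.IsBigO.of_bound K (eventually_inf_principal.2 (Eventually.of_forall ?_))
  intro w hw
  have := hexp w hw.1 hw.2
  simpa [Real.rpow_one] using this

theorem diffContOnCl_mul_exp {f : ℂ → ℂ} {s : Set ℂ} (hf : DiffContOnCl ℂ f s) (a : ℂ) :
    DiffContOnCl ℂ (fun z => f z * Complex.exp (a * z)) s := by
  have h : Differentiable ℂ fun z => Complex.exp (a * z) := by fun_prop
  simpa [smul_eq_mul, mul_comm] using h.diffContOnCl.smul hf

/-- From exponential type `T` along the positive real axis to the right half-plane. -/
theorem norm_le_exp_re_of_real {f : ℂ → ℂ} {C B T : ℝ} (hC : 0 ≤ C)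
    (hd : DiffContOnCl ℂ f {z | 0 < z.re})
    (hexp : ∀ z : ℂ, 0 ≤ z.re → ‖f z‖ ≤ C * Real.exp (B * ‖z‖))
    (him : ∀ y : ℝ, ‖f (y * Complex.I)‖ ≤ C)
    (hre : ∀ x : ℝ, 0 ≤ x → ‖f x‖ ≤ C * Real.exp (T * x)) {z : ℂ} (hz : 0 ≤ z.re) :
    ‖f z‖ ≤ C * Real.exp (T * z.re) := by
  have hn : ∀ w : ℂ, ‖f w * Complex.exp (((-T : ℝ) : ℂ) * w)‖ = ‖f w‖ * Real.exp (-(T * w.re)) := by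
    intro w
    rw [norm_mul, Complex.norm_exp, Complex.re_ofReal_mul, neg_mul]
  have key : ‖f z * Complex.exp (((-T : ℝ) : ℂ) * z)‖ ≤ C := by
    refine PhragmenLindelof.right_half_plane_of_bounded_on_real
      (f := fun w => f w * Complex.exp (((-T : ℝ) : ℂ) * w)) (diffContOnCl_mul_exp hd _)
      ⟨1, by norm_num, B + |T|, ?_⟩ ?_ ?_ hz
    · refine Asymptotics.IsBigO.of_bound C (eventually_inf_principal.2 (Eventually.of_forall ?_))
      intro w (hw : 0 < w.re)
      rw [hn, Real.rpow_one, Real.norm_eq_abs, Real.abs_exp, add_mul, Real.exp_add, ← mul_assoc]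
      have h1 : -(T * w.re) ≤ |T| * ‖w‖ := by
        refine (neg_le_abs _).trans ?_
        rw [abs_mul]
        exact mul_le_mul_of_nonneg_left (Complex.abs_re_le_norm w) (abs_nonneg _)
      exact mul_le_mul (hexp w hw.le) (Real.exp_le_exp.2 h1) (Real.exp_pos _).le (by positivity)
    · refine ⟨C, eventually_map.2 ?_⟩
      filter_upwards [eventually_ge_atTop 0] with x hx
      rw [hn, Complex.ofReal_re, Real.exp_neg]
      exact (mul_inv_le_iff₀ (Real.exp_pos _)).2 (hre x hx)
    · intro y
      rw [hn]
      simpa using him y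
  rw [hn, Real.exp_neg] at key
  exact (mul_inv_le_iff₀ (Real.exp_pos _)).1 key

/-- A function on the right half-plane with the growth of `exp (b (|w| - |Im w|))` is bounded. -/
theorem norm_le_of_half_plane {f : ℂ → ℂ} {C b : ℝ} (hC : 0 ≤ C) (hb : 0 < b)
    (hd : DiffContOnCl ℂ f {z | 0 < z.re})
    (hexp : ∀ z : ℂ, 0 ≤ z.re → ‖f z‖ ≤ C * Real.exp (b * (‖z‖ - |z.im|)))
    {z : ℂ} (hz : 0 ≤ z.re) : ‖f z‖ ≤ C := by
  have hexp' : ∀ z : ℂ, 0 ≤ z.re → ‖f z‖ ≤ C * Real.exp (b * ‖z‖) := fun z hz =>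
    (hexp z hz).trans (by gcongr; linarith [abs_nonneg z.im])
  have him : ∀ y : ℝ, ‖f (y * Complex.I)‖ ≤ C := fun y => by
    simpa using hexp (y * Complex.I) (by simp)
  -- The admissible exponential types form a closed set, so a least one `T` exists. If `T > 0`, the
  -- estimate below produces a smaller one.
  set S : Set ℝ := {T | 0 ≤ T ∧ ∀ z : ℂ, 0 ≤ z.re → ‖f z‖ ≤ C * Real.exp (T * z.re)} with hS
  have hSc : IsClosed S := by
    have : S = Ici 0 ∩ ⋂ (z : ℂ) (_ : 0 ≤ z.re), {T | ‖f z‖ ≤ C * Real.exp (T * z.re)} := by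
      ext T; simp [hS]
    rw [this]
    refine isClosed_Ici.inter (isClosed_iInter fun z => isClosed_iInter fun _ => ?_)
    exact isClosed_le continuous_const (by fun_prop)
  have hbS : b ∈ S := ⟨hb.le, fun z hz => norm_le_exp_re_of_real hC hd hexp' him (fun x hx => by
    have := hexp x (by simpa using hx)
    simpa [abs_of_nonneg hx] using this) hz⟩
  have hbdd : BddBelow S := ⟨0, fun T hT => hT.1⟩
  have hmem : sInf S ∈ S := hSc.csInf_mem ⟨b, hbS⟩ hbdd
  have hle : sInf S ≤ b := csInf_le hbdd hbS
  set T := sInf S with hT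
  suffices hT0 : T = 0 by
    have := hmem.2 z hz
    simpa [hT0] using this
  by_contra hne
  have hTpos : 0 < T := lt_of_le_of_ne hmem.1 (Ne.symm hne)
  -- The quadrant is rotated clockwise by the angle with sine `s` and cosine `c`. Its edges then
  -- carry the types `T c` (from the minimality data) and `b (1 - c)` (from the hypothesis), and the
  -- factor `exp (A ζ)` cancels both. The choice gives `b s = T / 2`, small enough for the final
  -- contradiction.
  set s : ℝ := T / (2 * b) with hs
  have hs0 : 0 < s := by positivity
  have hs1 : s < 1 := by rw [hs, div_lt_one (by positivity)]; linarith
  set c : ℝ := √(1 - s ^ 2) with hc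
  have hcs : c ^ 2 + s ^ 2 = 1 := by
    rw [hc, Real.sq_sqrt (by nlinarith)]; ring
  have hc0 : 0 < c := Real.sqrt_pos.2 (by nlinarith)
  have hc1 : c ≤ 1 := by nlinarith
  set ρ : ℂ := ⟨c, -s⟩ with hρ
  have hρn : ‖ρ‖ = 1 := by
    rw [Complex.norm_def, Complex.normSq_apply, hρ]
    simp only
    rw [show c * c + -s * -s = 1 by nlinarith, Real.sqrt_one]
  set A : ℂ := ⟨-(T * c), b * (1 - c)⟩ with hA
  have hAre : ∀ ζ : ℂ, (A * ζ).re = -(T * c * ζ.re + b * (1 - c) * ζ.im) := fun ζ => by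
    rw [Complex.mul_re, hA]; ring
  have hρre : ∀ ζ : ℂ, (ρ * ζ).re = c * ζ.re + s * ζ.im := fun ζ => by
    rw [Complex.mul_re, hρ]; ring
  have hρim : ∀ ζ : ℂ, (ρ * ζ).im = c * ζ.im - s * ζ.re := fun ζ => by
    rw [Complex.mul_im, hρ]; ring
  have hgn : ∀ ζ : ℂ, ‖f (ρ * ζ) * Complex.exp (A * ζ)‖ =
      ‖f (ρ * ζ)‖ * Real.exp (-(T * c * ζ.re + b * (1 - c) * ζ.im)) := fun ζ => by
    rw [norm_mul, Complex.norm_exp, hAre]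
  have hmaps : MapsTo (fun ζ : ℂ => ρ * ζ) (Ioi 0 ×ℂ Ioi 0) {z | 0 < z.re} := by
    intro ζ hζ
    have h1 : 0 < ζ.re := hζ.1
    have h2 : 0 < ζ.im := hζ.2
    show 0 < (ρ * ζ).re
    rw [hρre]; positivity
  have hdρ : Differentiable ℂ fun ζ : ℂ => ρ * ζ := by fun_prop
  have hgd : DiffContOnCl ℂ (fun ζ => f (ρ * ζ) * Complex.exp (A * ζ)) (Ioi 0 ×ℂ Ioi 0) :=
    diffContOnCl_mul_exp (hd.comp hdρ.diffContOnCl hmaps) A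
  have hquad : ∀ ζ : ℂ, 0 ≤ ζ.re → 0 ≤ ζ.im → ‖f (ρ * ζ) * Complex.exp (A * ζ)‖ ≤ C := by
    intro ζ h1 h2
    refine norm_le_of_quadrant (B := b) (K := C) hgd ?_ ?_ ?_ h1 h2
    · intro w hw1 hw2
      rw [hgn]
      have h3 := hexp' (ρ * w) (by rw [hρre]; positivity)
      rw [norm_mul, hρn, one_mul] at h3
      have h4 : Real.exp (-(T * c * w.re + b * (1 - c) * w.im)) ≤ 1 := by
        rw [Real.exp_le_one_iff]
        have : 0 ≤ 1 - c := by linarith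
        have : 0 ≤ T * c * w.re + b * (1 - c) * w.im := by positivity
        linarith
      calc _ ≤ (C * Real.exp (b * ‖w‖)) * 1 := mul_le_mul h3 h4 (Real.exp_pos _).le (by positivity)
        _ = _ := mul_one _
    · intro x hx
      rw [hgn, Complex.ofReal_re, Complex.ofReal_im, mul_zero, add_zero, Real.exp_neg]
      refine (mul_inv_le_iff₀ (Real.exp_pos _)).2 ?_
      have h3 := hmem.2 (ρ * x) (by rw [hρre]; simp; positivity)
      rw [hρre] at h3
      simpa [mul_assoc] using h3
    · intro y hy
      rw [hgn, Real.exp_neg]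
      refine (mul_inv_le_iff₀ (Real.exp_pos _)).2 ?_
      have h3 := hexp (ρ * (y * Complex.I)) (by rw [hρre]; simp; positivity)
      rw [hρim, norm_mul, hρn] at h3
      simp only [Complex.mul_im, Complex.mul_re, Complex.ofReal_re, Complex.ofReal_im,
        Complex.I_re, Complex.I_im, norm_mul, Complex.norm_real, Complex.norm_I,
        Real.norm_eq_abs] at h3 ⊢
      refine h3.trans (le_of_eq ?_)
      rw [abs_of_nonneg hy]
      have : |c * (y * 1 + 0 * 0) - s * (y * 0 - 0 * 1)| = c * y := by
        rw [show c * (y * 1 + 0 * 0) - s * (y * 0 - 0 * 1) = c * y by ring,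
          abs_of_nonneg (by positivity)]
      rw [this]
      congr 2
      ring
  -- The positive real axis corresponds to `ζ = (c x, s x)`, so the type read off there is `T c² + b
  -- (1 - c) s`. Since `1 - c ≤ s²`, it falls below `T`.
  have hT' : T * c ^ 2 + b * (1 - c) * s ∈ S := by
    have h1c : 0 ≤ 1 - c := by linarith
    refine ⟨by positivity, fun z hz => norm_le_exp_re_of_real hC hd hexp' him (fun x hx => ?_) hz⟩
    set ζ : ℂ := ⟨c * x, s * x⟩ with hζ
    have h3 := hquad ζ (by rw [hζ]; positivity) (by rw [hζ]; positivity)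
    have h4 : ρ * ζ = x := by
      apply Complex.ext
      · rw [hρre, hζ, Complex.ofReal_re]
        simp only
        linear_combination x * hcs
      · rw [hρim, hζ, Complex.ofReal_im]
        simp only
        ring
    rw [hgn, h4, Real.exp_neg] at h3
    refine ((mul_inv_le_iff₀ (Real.exp_pos _)).1 h3).trans (le_of_eq ?_)
    congr 2
    rw [hζ]
    ring
  have h5 : T ≤ T * c ^ 2 + b * (1 - c) * s := csInf_le hbdd hT'
  have h6 : 1 - c ≤ s ^ 2 := by nlinarith
  have h7 : b * s = T / 2 := by rw [hs]; field_simp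
  have h8 : T * s ^ 2 ≤ (T / 2) * s ^ 2 := by
    calc T * s ^ 2 = T - T * c ^ 2 := by linear_combination T * hcs
      _ ≤ (b * s) * (1 - c) := by linarith
      _ ≤ _ := by rw [h7]; gcongr
  nlinarith [pow_pos hs0 2, mul_pos hTpos (pow_pos hs0 2)]


/-! ### The function `sineProduct` and its simple zeros. -/

theorem sineProduct_eq_dslope (z : ℂ) : sineProduct z =
    (z ^ 2 - 1) * (Real.pi / 2) * dslope Complex.sin 0 (Real.pi * z ^ 2 / 2) := by
  have hpi : (Real.pi : ℂ) ≠ 0 := by exact_mod_cast Real.pi_ne_zero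
  unfold sineProduct
  split_ifs with hz
  · simp [hz]
  · have h : (Real.pi * z ^ 2 / 2 : ℂ) ≠ 0 := by
      simp [hz]
    rw [dslope_of_ne _ h, slope_def_field, Complex.sin_zero]
    field_simp
    ring

theorem differentiable_sineProduct : Differentiable ℂ sineProduct := by
  have h : Differentiable ℂ (dslope Complex.sin 0) :=
    differentiable_dslope Complex.differentiable_sin 0
  rw [show sineProduct = _ from funext sineProduct_eq_dslope]
  have h2 : Differentiable ℂ fun z : ℂ => (Real.pi * z ^ 2 / 2 : ℂ) := by fun_prop
  have h3 : Differentiable ℂ fun z : ℂ => (z ^ 2 - 1) * (Real.pi / 2 : ℂ) := by fun_prop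
  exact h3.mul (h.comp h2)

theorem sineProduct_mul_sq (z : ℂ) :
    sineProduct z * z ^ 2 = (z ^ 2 - 1) * Complex.sin (Real.pi * z ^ 2 / 2) := by
  unfold sineProduct
  split_ifs with hz
  · simp [hz]
  · field_simp

theorem sineProduct_zero : sineProduct 0 ≠ 0 := by
  simp [sineProduct, Real.pi_ne_zero]

theorem sin_pi_mul_div_two_eq_zero_iff {w : ℂ} :
    Complex.sin (Real.pi * w / 2) = 0 ↔ ∃ k : ℤ, w = 2 * k := by
  have hpi : (Real.pi : ℂ) ≠ 0 := by exact_mod_cast Real.pi_ne_zero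
  rw [Complex.sin_eq_zero_iff]
  refine exists_congr fun k => ⟨fun h => ?_, fun h => ?_⟩
  · have : (Real.pi : ℂ) * (w - 2 * k) = 0 := by linear_combination 2 * h
    have := (mul_eq_zero.1 this).resolve_left hpi
    linear_combination this
  · rw [h]; ring

theorem sineProduct_eq_zero_iff {z : ℂ} :
    sineProduct z = 0 ↔ z ≠ 0 ∧ (z ^ 2 = 1 ∨ ∃ k : ℤ, z ^ 2 = 2 * k) := by
  constructor
  · intro h
    have hz : z ≠ 0 := by rintro rfl; exact sineProduct_zero h
    have := sineProduct_mul_sq z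
    rw [h, zero_mul, eq_comm, mul_eq_zero, sub_eq_zero, sin_pi_mul_div_two_eq_zero_iff] at this
    exact ⟨hz, this⟩
  · rintro ⟨hz, h⟩
    rw [← sin_pi_mul_div_two_eq_zero_iff, ← sub_eq_zero, ← mul_eq_zero, ← sineProduct_mul_sq] at h
    exact (mul_eq_zero.1 h).resolve_right (pow_ne_zero 2 hz)

theorem sq_eq_two_mul_nat_iff {z : ℂ} {n : ℕ} :
    z ^ 2 = 2 * n ↔ z = (√(2 * n) : ℝ) ∨ z = -(√(2 * n) : ℝ) := by
  rw [← sq_eq_sq_iff_eq_or_eq_neg]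
  norm_cast
  rw [Real.sq_sqrt (by positivity)]
  norm_cast

theorem sq_eq_neg_two_mul_nat_iff {z : ℂ} {n : ℕ} :
    z ^ 2 = -(2 * n) ↔ z = Complex.I * (√(2 * n) : ℝ) ∨ z = -(Complex.I * (√(2 * n) : ℝ)) := by
  rw [← sq_eq_sq_iff_eq_or_eq_neg, mul_pow, Complex.I_sq, neg_one_mul]
  norm_cast
  rw [Real.sq_sqrt (by positivity)]
  norm_cast

theorem toComplexSet_crossSet : toComplexSet crossSet = {z : ℂ | sineProduct z = 0} := by
  ext z
  rw [mem_ofPred_eq, sineProduct_eq_zero_iff]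
  constructor
  · rintro ⟨p, hp, rfl⟩
    rcases hp with ((hp | hp) | ⟨n, hn, hp⟩) | ⟨n, hn, hp⟩
    · rw [hp]; simp
    · rw [mem_singleton_iff.1 hp]; simp
    · have h : ((p.1 : ℂ) + Complex.I * p.2) ^ 2 = -(2 * n) := by
        rw [sq_eq_neg_two_mul_nat_iff]
        rcases hp with hp | hp <;> rw [hp] <;> simp
      refine ⟨fun h0 => ?_, Or.inr ⟨-n, by rw [h]; push_cast; ring⟩⟩
      rw [show (p.1 : ℂ) + Complex.I * p.2 = 0 from h0] at h
      have : n = 0 := by simpa using h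
      omega
    · have h : ((p.1 : ℂ) + Complex.I * p.2) ^ 2 = 2 * n := by
        rw [sq_eq_two_mul_nat_iff]
        rcases hp with hp | hp <;> rw [hp] <;> simp
      refine ⟨fun h0 => ?_, Or.inr ⟨n, by rw [h]; push_cast; ring⟩⟩
      rw [show (p.1 : ℂ) + Complex.I * p.2 = 0 from h0] at h
      have : n = 0 := by simpa using h
      omega
  · rintro ⟨hz, h | ⟨k, hk⟩⟩
    · rcases (sq_eq_sq_iff_eq_or_eq_neg.1 (h.trans (one_pow 2).symm)) with rfl | rfl
      · exact ⟨(1, 0), Or.inl (Or.inl (by simp)), by simp⟩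
      · exact ⟨(-1, 0), Or.inl (Or.inl (by simp)), by simp⟩
    · have hk0 : k ≠ 0 := by
        rintro rfl
        simp at hk
        exact hz hk
      obtain ⟨n, rfl | rfl⟩ := k.eq_nat_or_neg
      · have hn : 1 ≤ n := by omega
        push_cast at hk
        rcases sq_eq_two_mul_nat_iff.1 hk with h | h
        · exact ⟨_, Or.inr ⟨n, hn, Or.inl rfl⟩, by simp [h]⟩
        · exact ⟨_, Or.inr ⟨n, hn, Or.inr rfl⟩, by simp [h]⟩
      · have hn : 1 ≤ n := by omega
        push_cast at hk
        rw [mul_neg] at hk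
        rcases sq_eq_neg_two_mul_nat_iff.1 hk with h | h
        · exact ⟨_, Or.inl (Or.inr ⟨n, hn, Or.inl rfl⟩), by simp [h]⟩
        · exact ⟨_, Or.inl (Or.inr ⟨n, hn, Or.inr rfl⟩), by simp [h]⟩

/-- Differentiate `s(z) z² = (z² - 1) sin(πz²/2)` at a zero. If `a² = 1` the sine equals 1; if `a² =
2k` the cosine is nonzero, and `a² ≠ 1` by parity. -/
theorem deriv_sineProduct_ne_zero {a : ℂ} (ha : sineProduct a = 0) : deriv sineProduct a ≠ 0 := by
  have hpi : (Real.pi : ℂ) ≠ 0 := by exact_mod_cast Real.pi_ne_zero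
  have h1 : HasDerivAt (fun z => sineProduct z * z ^ 2)
      (deriv sineProduct a * a ^ 2 + sineProduct a * (2 * a)) a := by
    have := (differentiable_sineProduct a).hasDerivAt.fun_mul (hasDerivAt_pow 2 a)
    simpa using this
  have h2 : HasDerivAt (fun z : ℂ => (z ^ 2 - 1) * Complex.sin (Real.pi * z ^ 2 / 2))
      (2 * a * Complex.sin (Real.pi * a ^ 2 / 2) +
        (a ^ 2 - 1) * (Complex.cos (Real.pi * a ^ 2 / 2) * (Real.pi * (2 * a) / 2))) a := by
    have h3 := (hasDerivAt_pow 2 a).sub_const 1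
    have h4 := (((hasDerivAt_pow 2 a).const_mul (Real.pi : ℂ)).div_const 2).csin
    simpa using h3.fun_mul h4
  rw [show (fun z => sineProduct z * z ^ 2) = _ from funext sineProduct_mul_sq] at h1
  have h5 := h1.unique h2
  rw [ha, zero_mul, add_zero] at h5
  intro h0
  rw [h0, zero_mul] at h5
  obtain ⟨ha0, h⟩ := sineProduct_eq_zero_iff.1 ha
  rcases h with h | h
  · rw [h, mul_one, Complex.sin_pi_div_two] at h5
    simp at h5
    exact ha0 h5
  · have hs := sin_pi_mul_div_two_eq_zero_iff.2 h
    have hc : Complex.cos (Real.pi * a ^ 2 / 2) ≠ 0 := by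
      intro hc
      have := Complex.sin_sq_add_cos_sq (Real.pi * a ^ 2 / 2)
      rw [hs, hc] at this
      simp at this
    have h1 : a ^ 2 - 1 ≠ 0 := by
      obtain ⟨k, hk⟩ := h
      rw [hk, sub_ne_zero]
      norm_cast
      omega
    rw [hs, mul_zero, zero_add, eq_comm] at h5
    simp [h1, hc, hpi, ha0] at h5

/-! ### Bounds for the sine and division by it in the half-plane. -/

theorem norm_sin_le_exp_abs_im (u : ℂ) : ‖Complex.sin u‖ ≤ Real.exp |u.im| := by
  have h1 : ‖Complex.exp (-u * Complex.I)‖ ≤ Real.exp |u.im| := by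
    rw [Complex.norm_exp]
    exact Real.exp_le_exp.2 (by simpa using le_abs_self u.im)
  have h2 : ‖Complex.exp (u * Complex.I)‖ ≤ Real.exp |u.im| := by
    rw [Complex.norm_exp]
    exact Real.exp_le_exp.2 (by simpa using neg_le_abs u.im)
  rw [Complex.sin, norm_div, norm_mul, Complex.norm_I, mul_one, Complex.norm_two]
  have := norm_sub_le (Complex.exp (-u * Complex.I)) (Complex.exp (u * Complex.I))
  linarith

theorem exp_abs_im_sub_le_norm_sin (u : ℂ) :
    (Real.exp |u.im| - Real.exp (-|u.im|)) / 2 ≤ ‖Complex.sin u‖ := by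
  have h1 : ‖Complex.exp (-u * Complex.I)‖ = Real.exp u.im := by
    rw [Complex.norm_exp]; simp
  have h2 : ‖Complex.exp (u * Complex.I)‖ = Real.exp (-u.im) := by
    rw [Complex.norm_exp]; simp
  rw [Complex.sin, norm_div, norm_mul, Complex.norm_I, mul_one, Complex.norm_two]
  have h3 := norm_sub_norm_le (Complex.exp (-u * Complex.I)) (Complex.exp (u * Complex.I))
  have h4 := norm_sub_norm_le (Complex.exp (u * Complex.I)) (Complex.exp (-u * Complex.I))
  rw [norm_sub_rev] at h4
  rw [h1, h2] at h3 h4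
  rcases abs_cases u.im with ⟨h, _⟩ | ⟨h, _⟩ <;> rw [h]
  · linarith
  · rw [neg_neg]; linarith

theorem exp_div_four_le_norm_sin {w : ℂ} (hw : 1 ≤ |w.im|) :
    Real.exp (Real.pi / 2 * |w.im|) / 4 ≤ ‖Complex.sin (Real.pi * w / 2)‖ := by
  have h := exp_abs_im_sub_le_norm_sin (Real.pi * w / 2)
  have him : |(Real.pi * w / 2 : ℂ).im| = Real.pi / 2 * |w.im| := by
    rw [show (Real.pi * w / 2 : ℂ) = ((Real.pi / 2 : ℝ) : ℂ) * w by push_cast; ring,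
      Complex.im_ofReal_mul, abs_mul, abs_of_pos (by positivity)]
  rw [him] at h
  set t := Real.pi / 2 * |w.im| with ht
  have ht1 : 1 ≤ t := by nlinarith [Real.pi_gt_three]
  have h1 : 2 ≤ Real.exp t := by linarith [Real.add_one_le_exp t]
  have h2 : Real.exp (-t) ≤ 1 := Real.exp_le_one_iff.2 (by linarith)
  linarith

/-- On these vertical lines the sine is, up to sign, a hyperbolic cosine. They serve as the vertical
sides of the boxes around its zeros. -/
theorem one_le_norm_sin_of_re_odd {w : ℂ} {n : ℕ} (hw : w.re = 2 * n + 1) :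
    1 ≤ ‖Complex.sin (Real.pi * w / 2)‖ := by
  have h0 : (Real.pi * w / 2 : ℂ) =
      (Real.pi / 2 * w.im : ℝ) * Complex.I + Real.pi / 2 + n * Real.pi := by
    conv_lhs => rw [← Complex.re_add_im w, hw]
    push_cast; ring
  rw [h0, Complex.sin_antiperiodic.add_nat_mul_eq, Complex.sin_add_pi_div_two, norm_mul,
    norm_pow, norm_neg, norm_one, one_pow, one_mul, Complex.cos_mul_I, ← Complex.ofReal_cosh,
    Complex.norm_real, Real.norm_eq_abs]
  exact (Real.one_le_cosh _).trans (le_abs_self _)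


/-- Removing the zeros of `sin (π w / 2)` in the right half-plane. -/
theorem exists_norm_le_of_mul_sin {f : ℂ → ℂ} {M : ℝ} (hM : 0 ≤ M)
    (hd : DiffContOnCl ℂ f {z | 0 < z.re})
    (hb : ∀ w : ℂ, 0 ≤ w.re → 2 ≤ ‖w‖ →
      ‖f w‖ * ‖Complex.sin (Real.pi * w / 2)‖ ≤ M * Real.exp (Real.pi / 2 * ‖w‖)) :
    ∃ C : ℝ, 0 ≤ C ∧ ∀ w : ℂ, 0 ≤ w.re →
      ‖f w‖ ≤ C * Real.exp (Real.pi / 2 * (‖w‖ - |w.im|)) := by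
  have hpi := Real.pi_pos
  have hcont : ContinuousOn f {z | 0 ≤ z.re} := by
    have := hd.continuousOn
    rwa [Complex.closure_setOfPred_lt_re] at this
  have hcpt : IsCompact (Metric.closedBall (0 : ℂ) 4 ∩ {z | 0 ≤ z.re}) :=
    (isCompact_closedBall 0 4).inter_right (isClosed_le continuous_const Complex.continuous_re)
  obtain ⟨K, hK⟩ := hcpt.exists_bound_of_continuousOn (hcont.mono inter_subset_right)
  have hK0 : 0 ≤ K := (norm_nonneg _).trans (hK 0 (by simp))
  have hpos : ∀ w : ℂ, 1 ≤ Real.exp (Real.pi / 2 * (‖w‖ - |w.im|)) := fun w => by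
    rw [Real.one_le_exp_iff]
    have := Complex.abs_im_le_norm w
    have : 0 ≤ ‖w‖ - |w.im| := by linarith
    positivity
  have hfar : ∀ w : ℂ, 0 ≤ w.re → 2 ≤ ‖w‖ → 1 ≤ |w.im| →
      ‖f w‖ ≤ 4 * M * Real.exp (Real.pi / 2 * (‖w‖ - |w.im|)) := by
    intro w h0 h2 h1
    have h3 := exp_div_four_le_norm_sin h1
    have h4 := (mul_le_mul_of_nonneg_left h3 (norm_nonneg (f w))).trans (hb w h0 h2)
    have h5 : Real.exp (Real.pi / 2 * ‖w‖) = Real.exp (Real.pi / 2 * (‖w‖ - |w.im|)) *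
        Real.exp (Real.pi / 2 * |w.im|) := by
      rw [← Real.exp_add]; congr 1; ring
    rw [h5] at h4
    have h6 := Real.exp_pos (Real.pi / 2 * |w.im|)
    refine le_of_mul_le_mul_right ?_ h6
    linarith
  refine ⟨K + 4 * M * Real.exp (2 * Real.pi), by positivity, fun w hw => ?_⟩
  have hexp1 : 1 ≤ Real.exp (2 * Real.pi) := Real.one_le_exp (by positivity)
  have hM' : 4 * M ≤ 4 * M * Real.exp (2 * Real.pi) := le_mul_of_one_le_right (by positivity) hexp1
  rcases le_or_gt ‖w‖ 4 with h4 | h4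
  · calc ‖f w‖ ≤ K := hK w ⟨by simpa using h4, hw⟩
      _ ≤ (K + 4 * M * Real.exp (2 * Real.pi)) * 1 := by linarith
      _ ≤ _ := by gcongr; exact hpos w
  rcases le_or_gt 1 |w.im| with h1 | h1
  · refine (hfar w hw (by linarith) h1).trans ?_
    gcongr
    linarith
  have hre : 3 < w.re := by
    have := Complex.norm_le_abs_re_add_abs_im w
    rw [abs_of_nonneg hw] at this
    linarith
  -- Now `w` is close to the real axis, where the sine may vanish. This `n` gives `2n - 1 ≤ Re w <
  -- 2n + 1`, and the maximum principle on the box of height 2 over that interval moves the estimate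
  -- to the boundary. As `n ≥ 2`, the whole box satisfies `‖z‖ ≥ 2`.
  obtain ⟨n, hn⟩ : ∃ n : ℕ, n = ⌊(w.re + 1) / 2⌋₊ := ⟨_, rfl⟩
  have hn1 : (n : ℝ) ≤ (w.re + 1) / 2 := by rw [hn]; exact Nat.floor_le (by linarith)
  have hn2 : (w.re + 1) / 2 < n + 1 := by rw [hn]; exact Nat.lt_floor_add_one _
  have hn3 : 2 ≤ n := by rw [hn]; exact Nat.le_floor (by push_cast; linarith)
  have hn3' : (2 : ℝ) ≤ n := by exact_mod_cast hn3
  have hmax : ‖f w‖ ≤ 4 * M * Real.exp (Real.pi / 2 * (2 * n + 2)) := by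
    have hU : Bornology.IsBounded (Ioo (2 * n - 1 : ℝ) (2 * n + 1) ×ℂ Ioo (-1 : ℝ) 1) :=
      (Metric.isBounded_Ioo _ _).reProdIm (Metric.isBounded_Ioo _ _)
    have hlt : (2 * n - 1 : ℝ) < 2 * n + 1 := by linarith
    have hsub : Ioo (2 * n - 1 : ℝ) (2 * n + 1) ×ℂ Ioo (-1 : ℝ) 1 ⊆ {z | 0 < z.re} := by
      intro z hz
      have : (2 * n - 1 : ℝ) < z.re := hz.1.1
      show 0 < z.re
      linarith
    refine Complex.norm_le_of_forall_mem_frontier_norm_le hU (hd.mono hsub) (fun z hz => ?_)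
      (z := w) ?_
    · rw [Complex.frontier_reProdIm, closure_Ioo hlt.ne, closure_Ioo (by norm_num),
        frontier_Ioo hlt, frontier_Ioo (by norm_num)] at hz
      have hbox : z.re ∈ Icc (2 * n - 1 : ℝ) (2 * n + 1) ∧ z.im ∈ Icc (-1 : ℝ) 1 := by
        rcases hz with ⟨h, h' | h'⟩ | ⟨h' | h', h⟩
        · exact ⟨h, by rw [h']; norm_num⟩
        · exact ⟨h, by rw [h']; norm_num⟩
        · exact ⟨by rw [h']; exact ⟨le_rfl, hlt.le⟩, h⟩
        · exact ⟨by rw [h']; exact ⟨hlt.le, le_rfl⟩, h⟩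
      have him : |z.im| ≤ 1 := abs_le.2 hbox.2
      have hz0 : 0 ≤ z.re := by linarith [hbox.1.1]
      have hzn : 2 ≤ ‖z‖ := by linarith [hbox.1.1, (le_abs_self _).trans (Complex.abs_re_le_norm z)]
      have hzn' : ‖z‖ ≤ 2 * n + 2 := by
        have := Complex.norm_le_abs_re_add_abs_im z
        rw [abs_of_nonneg hz0] at this
        linarith [hbox.1.2]
      have hsides : z.re = 2 * n - 1 ∨ z.re = 2 * n + 1 ∨ |z.im| = 1 := by
        rcases hz with ⟨h, h' | h'⟩ | ⟨h' | h', h⟩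
        · rw [h']; norm_num
        · rw [mem_singleton_iff.1 h']; norm_num
        · exact Or.inl h'
        · exact Or.inr (Or.inl h')
      have hodd : ∀ m : ℕ, z.re = 2 * m + 1 →
          ‖f z‖ ≤ 4 * M * Real.exp (Real.pi / 2 * (2 * n + 2)) := by
        intro m hm
        have h5 := one_le_norm_sin_of_re_odd hm
        have h6 := hb z hz0 hzn
        calc ‖f z‖ ≤ ‖f z‖ * ‖Complex.sin (Real.pi * z / 2)‖ :=
              le_mul_of_one_le_right (norm_nonneg _) h5
          _ ≤ M * Real.exp (Real.pi / 2 * ‖z‖) := h6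
          _ ≤ 4 * M * Real.exp (Real.pi / 2 * (2 * n + 2)) := by gcongr; linarith
      rcases hsides with h | h | h
      · refine hodd (n - 1) ?_
        rw [h, Nat.cast_sub (by omega)]
        push_cast; ring
      · exact hodd n h
      · refine (hfar z hz0 hzn h.ge).trans ?_
        gcongr
        linarith [abs_nonneg z.im]
    · rw [Complex.closure_reProdIm, closure_Ioo hlt.ne, closure_Ioo (by norm_num)]
      exact ⟨⟨by linarith, by linarith⟩, abs_le.1 h1.le⟩
  calc ‖f w‖ ≤ 4 * M * Real.exp (Real.pi / 2 * (2 * n + 2)) := hmax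
    -- The extra `2π` covers the width of the box: `2n + 2 = 4 + (2n - 2)` and `2n - 2 ≤ ‖w‖ - |Im
    -- w|`.
    _ ≤ 4 * M * Real.exp (2 * Real.pi + Real.pi / 2 * (‖w‖ - |w.im|)) := by
      gcongr
      have h5 : 2 * n - 2 ≤ ‖w‖ - |w.im| := by
        linarith [(le_abs_self _).trans (Complex.abs_re_le_norm w)]
      nlinarith
    _ = 4 * M * Real.exp (2 * Real.pi) * Real.exp (Real.pi / 2 * (‖w‖ - |w.im|)) := by
      rw [Real.exp_add, ← mul_assoc]
    _ ≤ _ := by gcongr; linarith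

/-! ### Uniqueness from growth and diagonal decay. -/

theorem sq_cpow_half {w : ℂ} : (w ^ (2⁻¹ : ℂ)) ^ 2 = w := by
  have := Complex.cpow_nat_inv_pow w two_ne_zero
  exact_mod_cast this

theorem diffContOnCl_cpow_half : DiffContOnCl ℂ (fun w : ℂ => w ^ (2⁻¹ : ℂ)) {z | 0 < z.re} := by
  refine ⟨fun w hw => ?_, fun w hw => ?_⟩
  · have hs : w ∈ Complex.slitPlane := Or.inl hw
    exact (differentiableAt_id.cpow_const hs).differentiableWithinAt
  · rw [Complex.closure_setOfPred_lt_re] at hw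
    by_cases h0 : w = 0
    · subst h0
      have : ContinuousAt (fun w : ℂ => w ^ (2⁻¹ : ℂ)) 0 := by
        refine Complex.continuousAt_cpow_zero_of_re_pos (z := 2⁻¹) (by norm_num) |>.comp
          (f := fun w : ℂ => (w, (2⁻¹ : ℂ))) (by fun_prop)
      exact this.continuousWithinAt
    · have hs : w ∈ Complex.slitPlane := by
        rcases lt_or_eq_of_le (show 0 ≤ w.re from hw) with h | h
        · exact Or.inl h
        · exact Or.inr fun h' => h0 (Complex.ext h.symm h')
      exact (continuousAt_id.cpow continuousAt_const hs).continuousWithinAt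

/-- On the diagonal `z² = 2it²` is purely imaginary, so the sine has its maximal growth and `|z² -
1| ≥ |z²|`. -/
theorem le_norm_sineProduct_diagonal {t : ℝ} (ht : 1 ≤ t) :
    Real.exp (Real.pi * t ^ 2) / 4 ≤ ‖sineProduct (t * (1 + Complex.I))‖ := by
  set z : ℂ := t * (1 + Complex.I) with hz
  have hz2 : z ^ 2 = (2 * t ^ 2 : ℝ) * Complex.I := by
    rw [hz, mul_pow, add_sq, Complex.I_sq]; push_cast; ring
  have h1 := exp_div_four_le_norm_sin (w := z ^ 2) (by
    rw [hz2, Complex.im_ofReal_mul, Complex.I_im, mul_one, abs_of_nonneg (by positivity)]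
    nlinarith)
  rw [show |(z ^ 2).im| = 2 * t ^ 2 by
    rw [hz2, Complex.im_ofReal_mul, Complex.I_im, mul_one, abs_of_nonneg (by positivity)],
    show Real.pi / 2 * (2 * t ^ 2) = Real.pi * t ^ 2 by ring] at h1
  have h2 := congrArg norm (sineProduct_mul_sq z)
  rw [norm_mul, norm_mul] at h2
  have h3 : ‖z ^ 2‖ = 2 * t ^ 2 := by
    rw [hz2, norm_mul, Complex.norm_I, mul_one, Complex.norm_real, Real.norm_eq_abs,
      abs_of_nonneg (by positivity)]
  have h4 : 2 * t ^ 2 ≤ ‖z ^ 2 - 1‖ := by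
    have := Complex.abs_im_le_norm (z ^ 2 - 1)
    rwa [Complex.sub_im, Complex.one_im, sub_zero, show |(z ^ 2).im| = 2 * t ^ 2 by
      rw [hz2, Complex.im_ofReal_mul, Complex.I_im, mul_one, abs_of_nonneg (by positivity)]] at this
  rw [h3] at h2
  have h5 : 0 < 2 * t ^ 2 := by positivity
  refine le_of_mul_le_mul_right ?_ h5
  rw [h2, mul_comm]
  gcongr

/-- Uniqueness for entire functions of Fock growth that decay along a diagonal. -/
theorem eq_zero_of_growth_of_decay {F : ℂ → ℂ} (hF : Differentiable ℂ F) {M : ℝ}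
    (hM : ∀ z, ‖F z‖ ≤ M * Real.exp (Real.pi / 2 * ‖z‖ ^ 2))
    (hlim : Tendsto (fun t : ℝ => ‖F (t * (1 + Complex.I))‖ * Real.exp (-(Real.pi * t ^ 2)))
      atTop (𝓝 0))
    (hzero : ∀ z, sineProduct z = 0 → F z = 0) (z : ℂ) : F z = 0 := by
  obtain ⟨q, hq, hFq⟩ := exists_differentiable_mul_eq hF differentiable_sineProduct
    (fun a ha => deriv_sineProduct_ne_zero ha) hzero
  have hM0 : 0 ≤ M := by
    have := (norm_nonneg _).trans (hM 0)
    simpa using this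
  have hsector : ∀ u : ℂ, u ^ 2 = 1 ∨ u ^ 2 = -1 → ∃ C : ℝ, ∀ w : ℂ, 0 ≤ w.re →
      ‖q (u * w ^ (2⁻¹ : ℂ))‖ ≤ C := by
    intro u hu
    have hun : ‖u‖ = 1 := by
      have : ‖u‖ ^ 2 = 1 := by
        rw [← norm_pow]
        rcases hu with h | h <;> simp [h]
      exact (pow_eq_one_iff_of_nonneg (norm_nonneg u) two_ne_zero).1 this
    have hd : DiffContOnCl ℂ (fun w : ℂ => q (u * w ^ (2⁻¹ : ℂ))) {z | 0 < z.re} := by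
      have h1 : Differentiable ℂ fun z => q (u * z) := hq.comp (by fun_prop)
      exact h1.comp_diffContOnCl diffContOnCl_cpow_half
    obtain ⟨C, hC0, hC⟩ := exists_norm_le_of_mul_sin (M := 2 * M) (by positivity) hd (by
      intro w hw0 hw2
      set z := u * w ^ (2⁻¹ : ℂ) with hz
      have hz2 : z ^ 2 = u ^ 2 * w := by rw [hz, mul_pow, sq_cpow_half]
      have hzn2 : ‖z‖ ^ 2 = ‖w‖ := by rw [← norm_pow, hz2, norm_mul, norm_pow, hun]; simp
      have hsin : ‖Complex.sin (Real.pi * z ^ 2 / 2)‖ = ‖Complex.sin (Real.pi * w / 2)‖ := by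
        rcases hu with h | h <;> rw [hz2, h]
        · rw [one_mul]
        · rw [neg_one_mul, mul_neg, neg_div, Complex.sin_neg, norm_neg]
      have h1 := congrArg norm (sineProduct_mul_sq z)
      rw [norm_mul, norm_mul, norm_pow, hzn2, hsin] at h1
      have h2 := hM z
      rw [hFq, norm_mul, hzn2] at h2
      -- Here `‖w‖ ≥ 2` enters: it keeps `z` away from the zeros `±1`, which the sine does not see.
      have h3 : ‖w‖ / 2 ≤ ‖z ^ 2 - 1‖ := by
        have := norm_sub_norm_le (z ^ 2) 1
        rw [norm_pow, hzn2, norm_one] at this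
        linarith
      have h4 : ‖Complex.sin (Real.pi * w / 2)‖ ≤ 2 * ‖sineProduct z‖ := by
        have hw : 0 < ‖w‖ / 2 := by linarith
        refine le_of_mul_le_mul_left ?_ hw
        calc ‖w‖ / 2 * ‖Complex.sin (Real.pi * w / 2)‖
            ≤ ‖z ^ 2 - 1‖ * ‖Complex.sin (Real.pi * w / 2)‖ := by gcongr
          _ = ‖w‖ / 2 * (2 * ‖sineProduct z‖) := by rw [← h1]; ring
      calc ‖q z‖ * ‖Complex.sin (Real.pi * w / 2)‖ ≤ ‖q z‖ * (2 * ‖sineProduct z‖) := by gcongr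
        _ = 2 * (‖sineProduct z‖ * ‖q z‖) := by ring
        _ ≤ 2 * (M * Real.exp (Real.pi / 2 * ‖w‖)) := by gcongr
        _ = _ := by ring)
    exact ⟨C, fun w hw => norm_le_of_half_plane hC0 (by positivity) hd hC hw⟩
  have hcover : ∀ u : ℂ, ∀ C, (∀ w : ℂ, 0 ≤ w.re →
      ‖q (u * w ^ (2⁻¹ : ℂ))‖ ≤ C) → ∀ v : ℂ, 0 < v.re → |v.im| ≤ v.re → ‖q (u * v)‖ ≤ C := by
    intro u C hC v hv hv'
    -- The condition `|Im v| ≤ Re v` says exactly that `v²` has nonnegative real part, so four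
    -- rotated copies of this sector cover the plane.
    have h := hC (v ^ 2) (by
      have := sq_le_sq' (by linarith [abs_nonneg v.im, neg_abs_le v.im]) ((le_abs_self _).trans hv')
      rw [sq, Complex.mul_re]
      nlinarith)
    rwa [Complex.sq_cpow_two_inv hv] at h
  obtain ⟨C1, hC1⟩ := hsector 1 (by simp)
  obtain ⟨C2, hC2⟩ := hsector (-1) (by simp)
  obtain ⟨C3, hC3⟩ := hsector Complex.I (by simp)
  obtain ⟨C4, hC4⟩ := hsector (-Complex.I) (by simp)
  have hbdd : Bornology.IsBounded (range q) := by
    refine isBounded_iff_forall_norm_le.2 ⟨max (max C1 C2) (max (max C3 C4) ‖q 0‖), ?_⟩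
    rintro _ ⟨v, rfl⟩
    by_cases hv0 : v = 0
    · subst hv0; simp
    rcases le_or_gt |v.im| |v.re| with h | h
    · have hre : v.re ≠ 0 := by
        intro h0
        rw [h0, abs_zero] at h
        exact hv0 (Complex.ext h0 (abs_nonpos_iff.1 h))
      rcases lt_or_gt_of_ne hre with h' | h'
      · have := hcover (-1) C2 hC2 (-v) (by simpa using h')
          (by simpa [abs_of_neg h'] using h)
        rw [neg_mul_neg, one_mul] at this
        simp [this]
      · have := hcover 1 C1 hC1 v h' (by simpa [abs_of_pos h'] using h)
        rw [one_mul] at this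
        simp [this]
    · have him : v.im ≠ 0 := by
        intro h0
        rw [h0, abs_zero] at h
        exact absurd h (not_lt.2 (abs_nonneg _))
      rcases lt_or_gt_of_ne him with h' | h'
      · have := hcover (-Complex.I) C4 hC4 (Complex.I * v) (by simpa using h')
          (by simpa [abs_of_neg h'] using h.le)
        rw [← mul_assoc, neg_mul, Complex.I_mul_I, neg_neg, one_mul] at this
        simp [this]
      · have := hcover Complex.I C3 hC3 (-Complex.I * v) (by simpa using h')
          (by simpa [abs_of_pos h'] using h.le)
        rw [← mul_assoc, mul_neg, Complex.I_mul_I, neg_neg, one_mul] at this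
        simp [this]
  have hconst : ∀ v, q v = q 0 := fun v => hq.apply_eq_apply_of_bounded hbdd v 0
  have hq0 : ‖q 0‖ / 4 ≤ 0 := by
    refine ge_of_tendsto hlim ?_
    filter_upwards [eventually_ge_atTop 1] with t ht
    rw [hFq, norm_mul, hconst (t * (1 + Complex.I)), Real.exp_neg]
    have h1 := le_norm_sineProduct_diagonal ht
    have h2 := Real.exp_pos (Real.pi * t ^ 2)
    rw [← div_eq_mul_inv, le_div_iff₀ h2]
    nlinarith [norm_nonneg (q 0)]
  have : q 0 = 0 := by
    rw [← norm_le_zero_iff]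
    linarith
  rw [hFq, hconst, this, mul_zero]


/-! ### Gaussian averages of square-integrable functions, used over both ℂ and ℝ. -/

section GaussianWindow

variable {E : Type*} [NormedAddCommGroup E] [MeasurableSpace E] [BorelSpace E] {μ : Measure E}

theorem integrable_sq_mul_gaussian {φ : E → ℝ} (hφ : Integrable (fun w => φ w ^ 2) μ) {c : ℝ}
    (hc : 0 < c) (z : E) : Integrable (fun w => φ w ^ 2 * Real.exp (-c * ‖w - z‖ ^ 2)) μ := by
  refine hφ.mono (hφ.1.mul (by fun_prop : Continuous _).aestronglyMeasurable) (Eventually.of_forall fun w => ?_)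
  rw [norm_mul, Real.norm_of_nonneg (Real.exp_pos _).le]
  exact mul_le_of_le_one_right (norm_nonneg _)
    (Real.exp_le_one_iff.2 (by rw [neg_mul, neg_nonpos]; positivity))

/-- Weighted AM–GM in place of Cauchy–Schwarz: `ε = 1` yields uniform bounds, small `ε` yields
decay. -/
theorem abs_mul_gaussian_le (a g : ℝ) (hg : 0 ≤ g) {ε : ℝ} (hε : 0 < ε) :
    |a| * g ≤ (2 * ε)⁻¹ * (a ^ 2 * g) + ε / 2 * g := by
  have h : |a| ≤ (2 * ε)⁻¹ * a ^ 2 + ε / 2 := by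
    rw [← sq_abs a]
    have h1 : (2 * ε)⁻¹ * |a| ^ 2 + ε / 2 - |a| = (2 * ε)⁻¹ * (|a| - ε) ^ 2 := by
      field_simp; ring
    have h2 : 0 ≤ (2 * ε)⁻¹ * (|a| - ε) ^ 2 := by positivity
    linarith
  nlinarith

variable [μ.IsAddRightInvariant]

theorem integrable_abs_mul_gaussian {φ : E → ℝ} (hm : AEStronglyMeasurable φ μ)
    (hφ : Integrable (fun w => φ w ^ 2) μ) {c : ℝ} (hc : 0 < c)
    (hγ : Integrable (fun w : E => Real.exp (-c * ‖w‖ ^ 2)) μ) (z : E) :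
    Integrable (fun w => |φ w| * Real.exp (-c * ‖w - z‖ ^ 2)) μ := by
  have h1 := (integrable_sq_mul_gaussian hφ hc z).const_mul (2 * 1)⁻¹
  have h2 := (hγ.comp_sub_right z).const_mul (1 / 2)
  refine (h1.add h2).mono'
    (hm.norm.mul (by fun_prop : Continuous _).aestronglyMeasurable)
    (Eventually.of_forall fun w => ?_)
  rw [Real.norm_of_nonneg (by positivity)]
  exact abs_mul_gaussian_le _ _ (Real.exp_pos _).le one_pos

theorem integral_abs_mul_gaussian_le {φ : E → ℝ} (hφ : Integrable (fun w => φ w ^ 2) μ) {c : ℝ}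
    (hc : 0 < c) (hγ : Integrable (fun w : E => Real.exp (-c * ‖w‖ ^ 2)) μ) (z : E) {ε : ℝ}
    (hε : 0 < ε) : ∫ w, |φ w| * Real.exp (-c * ‖w - z‖ ^ 2) ∂μ ≤
      (2 * ε)⁻¹ * ∫ w, φ w ^ 2 * Real.exp (-c * ‖w - z‖ ^ 2) ∂μ +
        ε / 2 * ∫ w, Real.exp (-c * ‖w‖ ^ 2) ∂μ := by
  have h1 := (integrable_sq_mul_gaussian hφ hc z).const_mul (2 * ε)⁻¹
  have h2 := (hγ.comp_sub_right z).const_mul (ε / 2)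
  calc _ ≤ ∫ w, ((2 * ε)⁻¹ * (φ w ^ 2 * Real.exp (-c * ‖w - z‖ ^ 2)) +
        ε / 2 * Real.exp (-c * ‖w - z‖ ^ 2)) ∂μ :=
        integral_mono_of_nonneg (Eventually.of_forall fun w => by positivity) (h1.add h2)
          (Eventually.of_forall fun w => abs_mul_gaussian_le _ _ (Real.exp_pos _).le hε)
    _ = _ := by
      rw [integral_add h1 h2, integral_const_mul, integral_const_mul,
        integral_sub_right_eq_self (fun w : E => Real.exp (-c * ‖w‖ ^ 2)) z]

theorem exists_integral_abs_mul_gaussian_le {φ : E → ℝ} (hφ : Integrable (fun w => φ w ^ 2) μ)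
    {c : ℝ} (hc : 0 < c) (hγ : Integrable (fun w : E => Real.exp (-c * ‖w‖ ^ 2)) μ) :
    ∃ M : ℝ, ∀ z, ∫ w, |φ w| * Real.exp (-c * ‖w - z‖ ^ 2) ∂μ ≤ M := by
  refine ⟨(2 * 1)⁻¹ * ∫ w, φ w ^ 2 ∂μ + 1 / 2 * ∫ w, Real.exp (-c * ‖w‖ ^ 2) ∂μ, fun z =>
    (integral_abs_mul_gaussian_le hφ hc hγ z one_pos).trans ?_⟩
  gcongr ?_ * ?_ + _
  refine integral_mono (integrable_sq_mul_gaussian hφ hc z) hφ fun w => ?_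
  exact mul_le_of_le_one_right (sq_nonneg _)
    (Real.exp_le_one_iff.2 (by rw [neg_mul, neg_nonpos]; positivity))

theorem tendsto_integral_abs_mul_gaussian {φ : E → ℝ} (hφ : Integrable (fun w => φ w ^ 2) μ)
    {c : ℝ} (hc : 0 < c) (hγ : Integrable (fun w : E => Real.exp (-c * ‖w‖ ^ 2)) μ)
    {z : ℝ → E} (hz : Tendsto (fun t => ‖z t‖) atTop atTop) :
    Tendsto (fun t => ∫ w, |φ w| * Real.exp (-c * ‖w - z t‖ ^ 2) ∂μ) atTop (𝓝 0) := by
  have hJ : Tendsto (fun t => ∫ w, φ w ^ 2 * Real.exp (-c * ‖w - z t‖ ^ 2) ∂μ) atTop (𝓝 0) := by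
    rw [show (0 : ℝ) = ∫ _, 0 ∂μ by simp]
    refine tendsto_integral_filter_of_dominated_convergence (fun w => φ w ^ 2)
      (Eventually.of_forall fun t => (integrable_sq_mul_gaussian hφ hc (z t)).1)
      (Eventually.of_forall fun t => Eventually.of_forall fun w => ?_) hφ
      (Eventually.of_forall fun w => ?_)
    · rw [Real.norm_of_nonneg (by positivity)]
      exact mul_le_of_le_one_right (sq_nonneg _)
        (Real.exp_le_one_iff.2 (by rw [neg_mul, neg_nonpos]; positivity))
    · have h1 : Tendsto (fun t => ‖w - z t‖) atTop atTop := by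
        refine tendsto_atTop_mono (fun t => ?_) (tendsto_atTop_add_const_right _ (-‖w‖) hz)
        have := norm_sub_norm_le (z t) w
        rw [norm_sub_rev] at this
        linarith
      have h2 : Tendsto (fun t => -c * ‖w - z t‖ ^ 2) atTop atBot :=
        ((tendsto_pow_atTop two_ne_zero).comp h1).const_mul_atTop_of_neg (by linarith)
      have := (Real.tendsto_exp_atBot.comp h2).const_mul (φ w ^ 2)
      simpa using this
  refine tendsto_order.2 ⟨fun a ha => Eventually.of_forall fun t =>
    ha.trans_le (integral_nonneg fun w => by positivity), fun δ hδ => ?_⟩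
  set G := ∫ w : E, Real.exp (-c * ‖w‖ ^ 2) ∂μ with hG
  have hG0 : 0 ≤ G := integral_nonneg fun w => (Real.exp_pos _).le
  set ε := δ / (G + 1) with hε
  have hε0 : 0 < ε := by positivity
  have h3 : ε * G < δ := by
    rw [hε, div_mul_eq_mul_div, div_lt_iff₀ (by positivity)]
    nlinarith
  -- The threshold `ε δ` makes the quadratic term less than `δ / 2`; the Gaussian term is less than
  -- `δ / 2` because `ε G < δ`.
  filter_upwards [(tendsto_order.1 hJ).2 (ε * δ) (by positivity)] with t ht
  refine (integral_abs_mul_gaussian_le hφ hc hγ (z t) hε0).trans_lt ?_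
  have h4 : (2 * ε)⁻¹ * ∫ w, φ w ^ 2 * Real.exp (-c * ‖w - z t‖ ^ 2) ∂μ < δ / 2 := by
    calc _ < (2 * ε)⁻¹ * (ε * δ) := by gcongr
      _ = δ / 2 := by field_simp
  linarith

end GaussianWindow

/-! ### The reproducing formula and Fock uniqueness. -/

theorem integrable_gaussian_complex {c : ℝ} (hc : 0 < c) :
    Integrable (fun w : ℂ => Real.exp (-c * ‖w‖ ^ 2)) := by
  have h := (GaussianFourier.integrable_cexp_neg_mul_sq_norm_add (V := ℂ) (b := c)
    (by simpa using hc) 0 0).norm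
  refine h.congr (Eventually.of_forall fun w => ?_)
  simp only [Complex.norm_exp]
  congr 1
  simp only [zero_mul, add_zero]
  rw [← Complex.ofReal_neg, ← Complex.ofReal_pow, Complex.re_ofReal_mul, Complex.ofReal_re]

theorem integrableOn_polarCoord {f : ℂ → ℂ} (hf : Integrable f) (hc : Continuous f) :
    IntegrableOn (fun p : ℝ × ℝ => p.1 • f (Complex.polarCoord.symm p)) polarCoord.target := by
  have hcs : Continuous fun p : ℝ × ℝ => Complex.polarCoord.symm p := by
    simp only [Complex.polarCoord_symm_apply]
    fun_prop
  refine ⟨(by fun_prop : Continuous _).aestronglyMeasurable, ?_⟩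
  have h := hf.2
  rw [hasFiniteIntegral_iff_enorm, ← Complex.lintegral_comp_polarCoord_symm] at h
  rw [hasFiniteIntegral_iff_enorm]
  refine lt_of_eq_of_lt (setLIntegral_congr_fun polarCoord.open_target.measurableSet ?_) h
  intro p hp
  have hp1 : 0 < p.1 := hp.1
  simp only [enorm_smul, smul_eq_mul]
  rw [Real.enorm_of_nonneg hp1.le]

theorem integral_circle_eq {H : ℂ → ℂ} (hH : Differentiable ℂ H) (r : ℝ) :
    ∫ θ in Ioo (-Real.pi) Real.pi, H (r * (Real.cos θ + Real.sin θ * Complex.I)) =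
      2 * Real.pi * H 0 := by
  have h1 : Real.circleAverage H 0 r = H 0 := hH.diffContOnCl.circleAverage
  rw [Real.circleAverage_eq_integral_add (-Real.pi),
    intervalIntegral.integral_comp_add_right (fun θ => H (circleMap 0 r θ))] at h1
  rw [← integral_Ioc_eq_integral_Ioo,
    ← intervalIntegral.integral_of_le (by linarith [Real.pi_pos])]
  have hpi : (2 * Real.pi : ℝ) ≠ 0 := by positivity
  rw [zero_add, show 2 * Real.pi + -Real.pi = Real.pi by ring, inv_smul_eq_iff₀ hpi] at h1
  have h2 : ∀ θ : ℝ, (r * (Real.cos θ + Real.sin θ * Complex.I) : ℂ) = circleMap 0 r θ := by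
    intro θ
    rw [circleMap_zero, Complex.exp_mul_I]
    push_cast
    rfl
  simp_rw [h2, h1]
  simp

/-- The Gaussian mean value property of entire functions. -/
theorem integral_mul_gaussian_eq {H : ℂ → ℂ} (hH : Differentiable ℂ H)
    (hint : Integrable fun w => H w * (Real.exp (-Real.pi * ‖w‖ ^ 2) : ℂ)) :
    ∫ w, H w * (Real.exp (-Real.pi * ‖w‖ ^ 2) : ℂ) = H 0 := by
  have hHc := hH.continuous
  have hI := integrableOn_polarCoord hint (by fun_prop)
  rw [← Complex.integral_comp_polarCoord_symm]
  rw [polarCoord_target, Measure.volume_eq_prod] at hI ⊢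
  rw [setIntegral_prod _ hI]
  have hpi : (Real.pi : ℂ) ≠ 0 := by exact_mod_cast Real.pi_ne_zero
  -- The mean value property on each circle leaves the radial integral, and the Gaussian has total
  -- mass 1.
  calc _ = ∫ r in Ioi (0 : ℝ), (2 * Real.pi * H 0) * ((r : ℂ) * Complex.exp (-Real.pi * r ^ 2)) := by
        refine setIntegral_congr_fun measurableSet_Ioi fun r hr => ?_
        have h1 : ∀ θ : ℝ, r • (H (Complex.polarCoord.symm (r, θ)) *
            (Real.exp (-Real.pi * ‖Complex.polarCoord.symm (r, θ)‖ ^ 2) : ℂ)) =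
            ((r : ℂ) * Complex.exp (-Real.pi * r ^ 2)) *
              H (r * (Real.cos θ + Real.sin θ * Complex.I)) := by
          intro θ
          rw [Complex.norm_polarCoord_symm, Complex.polarCoord_symm_apply, sq_abs,
            Complex.real_smul]
          push_cast
          ring
        simp only [h1]
        rw [integral_const_mul, integral_circle_eq hH]
        ring
    _ = H 0 := by
        rw [integral_const_mul, integral_mul_cexp_neg_mul_sq (by simpa using Real.pi_pos)]
        field_simp

theorem MemFock.integrable_sq {F : ℂ → ℂ} (hF : MemFock F) :
    Integrable (fun w : ℂ => (‖F w‖ * Real.exp (-(Real.pi / 2) * ‖w‖ ^ 2)) ^ 2) := by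
  refine hF.2.congr (Eventually.of_forall fun w => ?_)
  simp only
  rw [mul_pow, ← Real.exp_nat_mul]
  congr 2
  push_cast
  ring

theorem MemFock.continuous_weighted {F : ℂ → ℂ} (hF : MemFock F) :
    Continuous fun w : ℂ => ‖F w‖ * Real.exp (-(Real.pi / 2) * ‖w‖ ^ 2) := by
  have := hF.1.continuous
  fun_prop

/-- Completing the square in `|w - z|²`; this turns the reproducing integral into a Gaussian average
centred at `z`. -/
theorem norm_mul_cexp_mul_gaussian (a z w : ℂ) :
    ‖a * Complex.exp (Real.pi * z * starRingEnd ℂ w) * (Real.exp (-Real.pi * ‖w‖ ^ 2) : ℂ)‖ =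
      Real.exp (Real.pi / 2 * ‖z‖ ^ 2) * (|‖a‖ * Real.exp (-(Real.pi / 2) * ‖w‖ ^ 2)| *
        Real.exp (-(Real.pi / 2) * ‖w - z‖ ^ 2)) := by
  have h1 : ‖w - z‖ ^ 2 = ‖w‖ ^ 2 + ‖z‖ ^ 2 - 2 * (z * starRingEnd ℂ w).re := by
    simp only [← Complex.normSq_eq_norm_sq, Complex.normSq_apply, Complex.sub_re, Complex.sub_im,
      Complex.mul_re, Complex.conj_re, Complex.conj_im]
    ring
  rw [abs_of_nonneg (by positivity), norm_mul, norm_mul, Complex.norm_exp, Complex.norm_real,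
    Real.norm_of_nonneg (Real.exp_pos _).le, mul_assoc (Real.pi : ℂ), Complex.re_ofReal_mul, h1]
  rw [mul_assoc, ← Real.exp_add, mul_assoc, ← Real.exp_add, mul_left_comm, ← Real.exp_add]
  congr 2
  ring

theorem integrable_mul_kernel {F : ℂ → ℂ} (hF : MemFock F) (z : ℂ) :
    Integrable (fun w => F w * Complex.exp (Real.pi * z * starRingEnd ℂ w) *
      (Real.exp (-Real.pi * ‖w‖ ^ 2) : ℂ)) := by
  have hFc := hF.1.continuous
  have hpi : 0 < Real.pi / 2 := by positivity
  refine ((integrable_abs_mul_gaussian hF.continuous_weighted.aestronglyMeasurable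
    hF.integrable_sq hpi (integrable_gaussian_complex hpi) z).const_mul
    (Real.exp (Real.pi / 2 * ‖z‖ ^ 2))).mono'
    (by fun_prop : Continuous _).aestronglyMeasurable (Eventually.of_forall fun w => ?_)
  rw [norm_mul_cexp_mul_gaussian]

/-- The reproducing formula of the Fock space. -/
theorem integral_mul_kernel {F : ℂ → ℂ} (hF : MemFock F) (z : ℂ) :
    ∫ w, F w * Complex.exp (Real.pi * z * starRingEnd ℂ w) *
      (Real.exp (-Real.pi * ‖w‖ ^ 2) : ℂ) = F z := by
  -- Translation by `z` cancels every factor antiholomorphic in `w` except the Gaussian, so the mean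
  -- value property at 0 applies.
  have h1 : ∀ w : ℂ, F (w + z) * Complex.exp (Real.pi * z * starRingEnd ℂ (w + z)) *
      (Real.exp (-Real.pi * ‖w + z‖ ^ 2) : ℂ) =
      (F (w + z) * Complex.exp (-Real.pi * starRingEnd ℂ z * w)) *
        (Real.exp (-Real.pi * ‖w‖ ^ 2) : ℂ) := by
    intro w
    rw [mul_assoc (F (w + z)), mul_assoc (F (w + z)), Complex.ofReal_exp, Complex.ofReal_exp,
      ← Complex.exp_add, ← Complex.exp_add]
    congr 2
    push_cast
    rw [← Complex.mul_conj', ← Complex.mul_conj', map_add]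
    ring
  have hint := (integrable_mul_kernel hF z).comp_add_right z
  simp only [h1] at hint
  rw [← integral_add_right_eq_self _ z]
  simp only [h1]
  have hd := hF.1
  rw [integral_mul_gaussian_eq (H := fun w => F (w + z) *
    Complex.exp (-Real.pi * starRingEnd ℂ z * w)) ?_ hint]
  · simp
  · have : Differentiable ℂ fun w => F (w + z) := hd.comp (by fun_prop)
    exact this.mul (by fun_prop)

theorem MemFock.norm_mul_le {F : ℂ → ℂ} (hF : MemFock F) (z : ℂ) :
    ‖F z‖ ≤ Real.exp (Real.pi / 2 * ‖z‖ ^ 2) *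
      ∫ w, |‖F w‖ * Real.exp (-(Real.pi / 2) * ‖w‖ ^ 2)| *
        Real.exp (-(Real.pi / 2) * ‖w - z‖ ^ 2) := by
  rw [← integral_const_mul]
  simp_rw [← norm_mul_cexp_mul_gaussian]
  conv_lhs => rw [← integral_mul_kernel hF z]
  exact norm_integral_le_integral_norm _

theorem isFockUniquenessSet_crossSet : IsFockUniquenessSet (toComplexSet crossSet) := by
  intro F hF hzero
  have hpi : 0 < Real.pi / 2 := by positivity
  obtain ⟨M, hM⟩ := exists_integral_abs_mul_gaussian_le hF.integrable_sq hpi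
    (integrable_gaussian_complex hpi)
  refine eq_zero_of_growth_of_decay hF.1 (M := M) (fun z => ?_) ?_ fun z hz =>
    hzero z (by rw [toComplexSet_crossSet]; exact hz)
  · rw [mul_comm]
    exact (hF.norm_mul_le z).trans (by gcongr; exact hM z)
  · have hn : ∀ t : ℝ, ‖(t * (1 + Complex.I) : ℂ)‖ ^ 2 = 2 * t ^ 2 := fun t => by
      rw [← Complex.normSq_eq_norm_sq, Complex.normSq_apply]
      simp
      ring
    have hz : Tendsto (fun t : ℝ => ‖(t * (1 + Complex.I) : ℂ)‖) atTop atTop := by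
      refine tendsto_atTop_mono (fun t => ?_) tendsto_id
      have := (le_abs_self _).trans (Complex.abs_re_le_norm (t * (1 + Complex.I)))
      simpa using this
    refine squeeze_zero (fun t => by positivity) (fun t => ?_)
      (tendsto_integral_abs_mul_gaussian hF.integrable_sq hpi (integrable_gaussian_complex hpi) hz)
    have h := hF.norm_mul_le (t * (1 + Complex.I))
    rw [hn, show Real.pi / 2 * (2 * t ^ 2) = Real.pi * t ^ 2 by ring] at h
    rw [Real.exp_neg]
    exact (mul_inv_le_iff₀' (Real.exp_pos _)).2 h


/-! ### Zero excess: dividing out one zero. -/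

theorem norm_sineProduct_mul_sq_le (z : ℂ) :
    ‖sineProduct z‖ * ‖z‖ ^ 2 ≤ ‖z ^ 2 - 1‖ * Real.exp (Real.pi * |z.re * z.im|) := by
  have h1 := congrArg norm (sineProduct_mul_sq z)
  rw [norm_mul, norm_mul, norm_pow] at h1
  rw [h1]
  gcongr
  refine (norm_sin_le_exp_abs_im _).trans_eq ?_
  congr 1
  rw [show (Real.pi * z ^ 2 / 2 : ℂ) = ((Real.pi / 2 : ℝ) : ℂ) * z ^ 2 by push_cast; ring,
    Complex.im_ofReal_mul, sq, Complex.mul_im, mul_comm z.im, ← two_mul, ← mul_assoc, abs_mul,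
    abs_of_pos (by positivity)]
  congr 1
  ring

theorem exists_norm_sq_dslope_sineProduct_le {a : ℂ} (ha : sineProduct a = 0) :
    ∃ C : ℝ, 0 ≤ C ∧ ∀ z : ℂ, ‖dslope sineProduct a z‖ ^ 2 ≤
      C * (Real.exp (2 * Real.pi * |z.re * z.im|) * (1 + ‖z‖ ^ 2)⁻¹) := by
  have hc := (differentiable_dslope differentiable_sineProduct a).continuous
  -- Outside this radius `‖z - a‖ ≥ ‖z‖ / 2` and `‖z‖ ≥ 1`, so dividing by `z - a` gains a factor of
  -- order `1 / ‖z‖`.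
  set R := 2 * ‖a‖ + 1 with hR
  have hR0 : 0 ≤ R := by positivity
  obtain ⟨K, hK⟩ := (isCompact_closedBall (0 : ℂ) R).exists_bound_of_continuousOn hc.continuousOn
  have hK0 : 0 ≤ K := (norm_nonneg _).trans (hK 0 (by simpa using hR0))
  refine ⟨32 + K ^ 2 * (1 + R ^ 2), by positivity, fun z => ?_⟩
  have he1 : 1 ≤ Real.exp (2 * Real.pi * |z.re * z.im|) := Real.one_le_exp (by positivity)
  rw [← mul_assoc, ← div_eq_mul_inv, le_div_iff₀ (by positivity)]
  rcases le_or_gt ‖z‖ R with h | h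
  · have hk := hK z (by simpa using h)
    calc ‖dslope sineProduct a z‖ ^ 2 * (1 + ‖z‖ ^ 2) ≤ K ^ 2 * (1 + R ^ 2) := by gcongr
      _ ≤ (32 + K ^ 2 * (1 + R ^ 2)) * 1 := by linarith
      _ ≤ _ := by gcongr
  · have hz1 : 1 ≤ ‖z‖ := by linarith [norm_nonneg a]
    have h1 : ‖z‖ / 2 ≤ ‖z - a‖ := by linarith [norm_sub_norm_le z a]
    have h2 : ‖z - a‖ * ‖dslope sineProduct a z‖ = ‖sineProduct z‖ := by
      have := sub_smul_dslope sineProduct a z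
      rw [ha, sub_zero, smul_eq_mul] at this
      rw [← norm_mul, this]
    have h3 : ‖sineProduct z‖ ≤ 2 * Real.exp (Real.pi * |z.re * z.im|) := by
      have h4 := norm_sineProduct_mul_sq_le z
      have h5 : ‖z ^ 2 - 1‖ ≤ 2 * ‖z‖ ^ 2 := by
        have := norm_sub_le (z ^ 2) 1
        rw [norm_pow, norm_one] at this
        nlinarith
      refine le_of_mul_le_mul_right (h4.trans ?_) (show 0 < ‖z‖ ^ 2 by positivity)
      rw [mul_right_comm]
      gcongr
    have h6 : ‖z‖ * ‖dslope sineProduct a z‖ ≤ 4 * Real.exp (Real.pi * |z.re * z.im|) := by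
      nlinarith [mul_le_mul_of_nonneg_right h1 (norm_nonneg (dslope sineProduct a z))]
    have h7 : (‖z‖ * ‖dslope sineProduct a z‖) ^ 2 ≤
        16 * Real.exp (2 * Real.pi * |z.re * z.im|) := by
      calc _ ≤ (4 * Real.exp (Real.pi * |z.re * z.im|)) ^ 2 := by gcongr
        _ = _ := by
          rw [mul_pow, ← Real.exp_nat_mul]
          push_cast
          ring_nf
    calc ‖dslope sineProduct a z‖ ^ 2 * (1 + ‖z‖ ^ 2)
        ≤ ‖dslope sineProduct a z‖ ^ 2 * (2 * ‖z‖ ^ 2) := by gcongr; nlinarith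
      _ = 2 * (‖z‖ * ‖dslope sineProduct a z‖) ^ 2 := by ring
      _ ≤ 32 * Real.exp (2 * Real.pi * |z.re * z.im|) := by linarith
      _ ≤ _ := by gcongr; linarith [show 0 ≤ K ^ 2 * (1 + R ^ 2) by positivity]

/-- The measure-preserving shear `(x, y) ↦ (x - y, y)` separates the variables. -/
theorem integrable_gaussian_diagonal_sub : Integrable fun z : ℂ =>
    Real.exp (-Real.pi * (z.re - z.im) ^ 2) * (1 + z.im ^ 2)⁻¹ := by
  have h1 : Integrable fun p : ℝ × ℝ => Real.exp (-Real.pi * p.1 ^ 2) * (1 + p.2 ^ 2)⁻¹ :=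
    (integrable_exp_neg_mul_sq Real.pi_pos).mul_prod integrable_inv_one_add_sq
  have h2 := (measurePreserving_sub_prod (volume : Measure ℝ)
    (volume : Measure ℝ)).integrable_comp_of_integrable h1
  exact Complex.volume_preserving_equiv_real_prod.integrable_comp_of_integrable h2

theorem integrable_gaussian_diagonal_add : Integrable fun z : ℂ =>
    Real.exp (-Real.pi * (z.re + z.im) ^ 2) * (1 + z.im ^ 2)⁻¹ := by
  have h := integrable_gaussian_diagonal_sub
  have h2 := (Complex.conjLIE.measurePreserving).integrable_comp_of_integrable h
  simpa [Function.comp_def] using h2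

theorem memFock_dslope_sineProduct {a : ℂ} (ha : sineProduct a = 0) :
    MemFock (dslope sineProduct a) := by
  have hd := differentiable_dslope differentiable_sineProduct a
  have hc := hd.continuous
  obtain ⟨C, hC0, hC⟩ := exists_norm_sq_dslope_sineProduct_le ha
  refine ⟨hd, ((integrable_gaussian_diagonal_sub.add integrable_gaussian_diagonal_add).const_mul
    C).mono' (by fun_prop : Continuous _).aestronglyMeasurable (Eventually.of_forall fun z => ?_)⟩
  rw [Real.norm_of_nonneg (by positivity)]
  have hn : ‖z‖ ^ 2 = z.re ^ 2 + z.im ^ 2 := by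
    rw [← Complex.normSq_eq_norm_sq, Complex.normSq_apply]; ring
  have h1 : Real.exp (2 * Real.pi * |z.re * z.im|) * Real.exp (-Real.pi * ‖z‖ ^ 2) ≤
      Real.exp (-Real.pi * (z.re - z.im) ^ 2) + Real.exp (-Real.pi * (z.re + z.im) ^ 2) := by
    rw [← Real.exp_add, hn]
    rcases abs_cases (z.re * z.im) with ⟨h, _⟩ | ⟨h, _⟩ <;> rw [h]
    · rw [show 2 * Real.pi * (z.re * z.im) + -Real.pi * (z.re ^ 2 + z.im ^ 2) =
        -Real.pi * (z.re - z.im) ^ 2 by ring]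
      linarith [Real.exp_pos (-Real.pi * (z.re + z.im) ^ 2)]
    · rw [show 2 * Real.pi * -(z.re * z.im) + -Real.pi * (z.re ^ 2 + z.im ^ 2) =
        -Real.pi * (z.re + z.im) ^ 2 by ring]
      linarith [Real.exp_pos (-Real.pi * (z.re - z.im) ^ 2)]
  have h2 : (1 + ‖z‖ ^ 2)⁻¹ ≤ (1 + z.im ^ 2)⁻¹ := by
    refine inv_anti₀ (by positivity) ?_
    rw [hn]
    linarith [sq_nonneg z.re]
  calc ‖dslope sineProduct a z‖ ^ 2 * Real.exp (-Real.pi * ‖z‖ ^ 2)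
      ≤ C * (Real.exp (2 * Real.pi * |z.re * z.im|) * (1 + ‖z‖ ^ 2)⁻¹) *
        Real.exp (-Real.pi * ‖z‖ ^ 2) := by gcongr; exact hC z
    _ = C * ((Real.exp (2 * Real.pi * |z.re * z.im|) * Real.exp (-Real.pi * ‖z‖ ^ 2)) *
        (1 + ‖z‖ ^ 2)⁻¹) := by ring
    _ ≤ C * ((Real.exp (-Real.pi * (z.re - z.im) ^ 2) + Real.exp (-Real.pi * (z.re + z.im) ^ 2)) *
        (1 + z.im ^ 2)⁻¹) := by gcongr
    _ = _ := by simp only [Pi.add_apply]; ring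

theorem dslope_sineProduct_self_ne_zero {a : ℂ} (ha : sineProduct a = 0) :
    dslope sineProduct a a ≠ 0 := by
  rw [dslope_same]
  exact deriv_sineProduct_ne_zero ha

theorem dslope_sineProduct_eq_zero {a z : ℂ} (ha : sineProduct a = 0) (hz : sineProduct z = 0)
    (hne : z ≠ a) : dslope sineProduct a z = 0 := by
  rw [dslope_of_ne _ hne, slope_def_field, ha, hz, sub_self, zero_div]

theorem isFockUniquenessSetOfZeroExcess_crossSet :
    IsFockUniquenessSetOfZeroExcess (toComplexSet crossSet) := by
  refine ⟨isFockUniquenessSet_crossSet, fun a ha h => ?_⟩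
  rw [toComplexSet_crossSet] at ha h
  exact dslope_sineProduct_self_ne_zero ha (h _ (memFock_dslope_sineProduct ha)
    (fun z hz => dslope_sineProduct_eq_zero ha hz.1 hz.2) a)

/-! ### The Bargmann integral and completeness. -/

open scoped FourierTransform InnerProductSpace SchwartzMap

/-- An integrable function with vanishing Fourier transform vanishes almost everywhere. -/
theorem ae_eq_zero_of_fourier_eq_zero {h : ℝ → ℂ} (hh : Integrable h) (h0 : ∀ ξ, 𝓕 h ξ = 0) :
    ∀ᵐ t, h t = 0 := by
  refine ae_eq_zero_of_integral_contDiff_smul_eq_zero hh.locallyIntegrable fun g hg hgc => ?_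
  have hgc' : HasCompactSupport fun t => (g t : ℂ) := hgc.comp_left Complex.ofReal_zero
  have hg' : ContDiff ℝ (⊤ : ℕ∞) fun t => (g t : ℂ) := Complex.ofRealCLM.contDiff.comp hg
  set ψ : 𝓢(ℝ, ℂ) := hgc'.toSchwartzMap hg' with hψ
  -- The multiplication formula tested on the inverse transform of `ψ`: its right side is the
  -- pairing of `h` with `ψ`.
  have h1 : ∫ ξ, (𝓕 h ξ) • ((𝓕⁻ ψ : 𝓢(ℝ, ℂ)) ξ) = ∫ x, h x • 𝓕 ((𝓕⁻ ψ : 𝓢(ℝ, ℂ)) : ℝ → ℂ) x := by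
    simpa using! VectorFourier.integral_fourierIntegral_smul_eq_flip (L := innerₗ ℝ)
      Real.continuous_fourierChar continuous_inner hh (𝓕⁻ ψ : 𝓢(ℝ, ℂ)).integrable
  rw [← SchwartzMap.fourier_coe, FourierTransform.fourier_fourierInv_eq] at h1
  simp only [h0, zero_smul, integral_zero] at h1
  rw [h1]
  refine integral_congr_ae (Eventually.of_forall fun t => ?_)
  simp [hψ, mul_comm]

/-- The Bargmann integral of `f`, without the factor `exp (-π z² / 2)`. -/
noncomputable def bargmannIntegral (f : ℝ → ℂ) (z : ℂ) : ℂ :=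
  ∫ t, f t * Complex.exp (-Real.pi * t ^ 2 + 2 * Real.pi * t * z)

theorem norm_cexp_bargmann (t : ℝ) (z : ℂ) :
    ‖Complex.exp (-Real.pi * t ^ 2 + 2 * Real.pi * t * z)‖ =
      Real.exp (-Real.pi * t ^ 2 + 2 * Real.pi * t * z.re) := by
  rw [Complex.norm_exp]
  congr 1
  rw [show (-Real.pi * t ^ 2 + 2 * Real.pi * t * z : ℂ) =
    ((-Real.pi * t ^ 2 : ℝ) : ℂ) + ((2 * Real.pi * t : ℝ) : ℂ) * z by push_cast; ring,
    Complex.add_re, Complex.ofReal_re, Complex.re_ofReal_mul]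

theorem exp_bargmann_le (t : ℝ) {x R : ℝ} (hx : |x| ≤ R) :
    Real.exp (-Real.pi * t ^ 2 + 2 * Real.pi * t * x) ≤
      Real.exp (2 * Real.pi * R ^ 2) * Real.exp (-(Real.pi / 2) * ‖t - 0‖ ^ 2) := by
  rw [← Real.exp_add, sub_zero, Real.norm_eq_abs]
  refine Real.exp_le_exp.2 ?_
  have h1 : t * x ≤ |t| * R := by
    calc t * x ≤ |t * x| := le_abs_self _
      _ = |t| * |x| := abs_mul _ _
      _ ≤ _ := by gcongr
  have h2 : 0 ≤ Real.pi / 2 * (|t| - 2 * R) ^ 2 := by positivity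
  have h3 : Real.pi * (t * x) ≤ Real.pi * (|t| * R) := by gcongr
  rw [← sq_abs t]
  linarith

section

variable {f : ℝ → ℂ}

theorem integrable_sq_norm_of_memLp (hf : MemLp f 2) : Integrable fun t => ‖f t‖ ^ 2 :=
  (memLp_two_iff_integrable_sq_norm hf.1).1 hf

theorem integrable_norm_mul_gaussian (hf : MemLp f 2) {c : ℝ} (hc : 0 < c) (x : ℝ) :
    Integrable fun t => |‖f t‖| * Real.exp (-c * ‖t - x‖ ^ 2) :=
  integrable_abs_mul_gaussian hf.1.norm (integrable_sq_norm_of_memLp hf) hc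
    (by simpa using integrable_exp_neg_mul_sq hc) x

theorem integrable_bargmann (hf : MemLp f 2) (z : ℂ) :
    Integrable fun t : ℝ => f t * Complex.exp (-Real.pi * t ^ 2 + 2 * Real.pi * t * z) := by
  refine ((integrable_norm_mul_gaussian hf (c := Real.pi / 2) (by positivity) 0).const_mul
    (Real.exp (2 * Real.pi * ‖z‖ ^ 2))).mono' (hf.1.mul
      (by fun_prop : Continuous _).aestronglyMeasurable) (Eventually.of_forall fun t => ?_)
  rw [norm_mul, norm_cexp_bargmann, abs_norm, mul_left_comm]
  gcongr
  exact exp_bargmann_le t (Complex.abs_re_le_norm z)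

theorem differentiable_bargmannIntegral (hf : MemLp f 2) :
    Differentiable ℂ (bargmannIntegral f) := by
  intro z
  have hR : 0 ≤ ‖z‖ + 1 := by positivity
  have h := hasDerivAt_integral_of_dominated_loc_of_deriv_le (μ := volume)
    (F := fun (w : ℂ) (t : ℝ) => f t * Complex.exp (-Real.pi * t ^ 2 + 2 * Real.pi * t * w))
    (F' := fun (w : ℂ) (t : ℝ) => f t * (Complex.exp (-Real.pi * t ^ 2 + 2 * Real.pi * t * w) *
      (2 * Real.pi * t)))
    (bound := fun t => Real.exp (2 * Real.pi * (‖z‖ + 1 + 1) ^ 2) *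
      (|‖f t‖| * Real.exp (-(Real.pi / 2) * ‖t - 0‖ ^ 2)))
    (x₀ := z) (Metric.ball_mem_nhds z one_pos)
    (Eventually.of_forall fun w => (integrable_bargmann hf w).1) (integrable_bargmann hf z)
    (hf.1.mul (by fun_prop : Continuous _).aestronglyMeasurable)
    (Eventually.of_forall fun t w hw => ?_)
    ((integrable_norm_mul_gaussian hf (by positivity) 0).const_mul _)
    (Eventually.of_forall fun t w hw => ?_)
  · exact h.2.differentiableAt
  · rw [norm_mul, norm_mul, norm_cexp_bargmann, abs_norm, mul_left_comm (Real.exp (_ * _))]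
    refine mul_le_mul_of_nonneg_left ?_ (norm_nonneg (f t))
    have hw' : |w.re| ≤ ‖z‖ + 1 := by
      have h1 : ‖w - z‖ < 1 := by simpa [dist_eq_norm] using hw
      have h2 := Complex.abs_re_le_norm w
      have h3 := norm_sub_norm_le w z
      linarith
    -- The factor produced by differentiation is absorbed by raising the radius `‖z‖ + 1` by one
    -- more unit.
    have h1 : ‖(2 * Real.pi * t : ℂ)‖ ≤ Real.exp (2 * Real.pi * |t|) := by
      have h2 : ‖(2 * Real.pi * t : ℂ)‖ = 2 * Real.pi * |t| := by
        rw [norm_mul, norm_mul, Complex.norm_real, Complex.norm_real, Real.norm_eq_abs,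
          Real.norm_eq_abs, abs_of_pos Real.pi_pos]
        simp
      rw [h2]
      linarith [Real.add_one_le_exp (2 * Real.pi * |t|)]
    have h2 : Real.exp (-Real.pi * t ^ 2 + 2 * Real.pi * t * w.re) ≤
        Real.exp (-Real.pi * |t| ^ 2 + 2 * Real.pi * |t| * (‖z‖ + 1)) := by
      rw [sq_abs, mul_assoc (2 * Real.pi), mul_assoc (2 * Real.pi)]
      refine Real.exp_le_exp.2 (add_le_add_right (mul_le_mul_of_nonneg_left ?_ (by positivity)) _)
      calc t * w.re ≤ |t * w.re| := le_abs_self _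
        _ = |t| * |w.re| := abs_mul _ _
        _ ≤ _ := by gcongr
    calc _ ≤ Real.exp (-Real.pi * |t| ^ 2 + 2 * Real.pi * |t| * (‖z‖ + 1)) *
          Real.exp (2 * Real.pi * |t|) := by gcongr
      _ = Real.exp (-Real.pi * |t| ^ 2 + 2 * Real.pi * |t| * (‖z‖ + 1 + 1)) := by
        rw [← Real.exp_add]; congr 1; ring
      _ ≤ Real.exp (2 * Real.pi * (‖z‖ + 1 + 1) ^ 2) *
          Real.exp (-(Real.pi / 2) * ‖|t| - 0‖ ^ 2) :=
        exp_bargmann_le |t| (by rw [abs_of_nonneg (by positivity)])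
      _ = _ := by simp
  · have h1 : HasDerivAt (fun w : ℂ => (-Real.pi * t ^ 2 + 2 * Real.pi * t * w : ℂ))
        (2 * Real.pi * t) w := by
      simpa using ((hasDerivAt_id w).const_mul (2 * Real.pi * t : ℂ)).const_add
        (-Real.pi * t ^ 2 : ℂ)
    exact h1.cexp.const_mul (f t)

/-- The factor `exp(-πz²/2)` has modulus `exp(π|z|²/2) exp(-π(Re z)²)`, which completes the square
in `t - Re z`. The window moves only with `Re z`, which still escapes to infinity along the
diagonal. -/
theorem norm_bargmann_le (z : ℂ) :
    ‖Complex.exp (-(Real.pi / 2) * z ^ 2) * bargmannIntegral f z‖ ≤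
      Real.exp (Real.pi / 2 * ‖z‖ ^ 2) *
        ∫ t, |‖f t‖| * Real.exp (-Real.pi * ‖t - z.re‖ ^ 2) := by
  rw [norm_mul]
  have h1 : ‖Complex.exp (-(Real.pi / 2) * z ^ 2)‖ =
      Real.exp (Real.pi / 2 * ‖z‖ ^ 2) * Real.exp (-Real.pi * z.re ^ 2) := by
    rw [Complex.norm_exp, ← Real.exp_add, ← Complex.normSq_eq_norm_sq, Complex.normSq_apply]
    congr 1
    rw [show (-(Real.pi / 2) * z ^ 2 : ℂ) = ((-(Real.pi / 2) : ℝ) : ℂ) * (z * z) by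
      push_cast; ring, Complex.re_ofReal_mul, Complex.mul_re]
    ring
  rw [h1, mul_assoc]
  gcongr
  calc Real.exp (-Real.pi * z.re ^ 2) * ‖bargmannIntegral f z‖
      ≤ Real.exp (-Real.pi * z.re ^ 2) * ∫ t : ℝ,
          ‖f t * Complex.exp (-Real.pi * t ^ 2 + 2 * Real.pi * t * z)‖ := by
        gcongr
        exact norm_integral_le_integral_norm _
    _ = _ := by
        rw [← integral_const_mul]
        refine integral_congr_ae (Eventually.of_forall fun t => ?_)
        simp only
        rw [norm_mul, norm_cexp_bargmann, abs_norm, mul_left_comm, ← Real.exp_add,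
          Real.norm_eq_abs, sq_abs]
        congr 2
        ring

theorem bargmannIntegral_eq_zero (hf : MemLp f 2)
    (hzero : ∀ z, sineProduct z = 0 → bargmannIntegral f z = 0) (z : ℂ) :
    bargmannIntegral f z = 0 := by
  have hg : Integrable fun t : ℝ => Real.exp (-Real.pi * ‖t‖ ^ 2) := by
    simpa using integrable_exp_neg_mul_sq Real.pi_pos
  obtain ⟨M, hM⟩ := exists_integral_abs_mul_gaussian_le (integrable_sq_norm_of_memLp hf)
    Real.pi_pos hg
  have h := eq_zero_of_growth_of_decay
    (F := fun z => Complex.exp (-(Real.pi / 2) * z ^ 2) * bargmannIntegral f z) (M := M)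
    ((by fun_prop : Differentiable ℂ fun z : ℂ => Complex.exp (-(Real.pi / 2) * z ^ 2)).mul
      (differentiable_bargmannIntegral hf)) (fun z => ?_) ?_
    (fun z hz => by simp only [hzero z hz, mul_zero]) z
  · exact (mul_eq_zero.1 h).resolve_left (Complex.exp_ne_zero _)
  · rw [mul_comm M]
    exact (norm_bargmann_le z).trans (by gcongr; exact hM z.re)
  · have hre : ∀ t : ℝ, (t * (1 + Complex.I) : ℂ).re = t := fun t => by simp
    refine squeeze_zero (fun t => by positivity) (fun t => ?_)
      (tendsto_integral_abs_mul_gaussian (integrable_sq_norm_of_memLp hf) Real.pi_pos hg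
        (z := fun t => t) tendsto_norm_atTop_atTop)
    have hn : ‖(t * (1 + Complex.I) : ℂ)‖ ^ 2 = 2 * t ^ 2 := by
      rw [← Complex.normSq_eq_norm_sq, Complex.normSq_apply]
      simp
      ring
    have h := norm_bargmann_le (f := f) (t * (1 + Complex.I))
    rw [hn, show Real.pi / 2 * (2 * t ^ 2) = Real.pi * t ^ 2 by ring, hre] at h
    rw [Real.exp_neg]
    exact (mul_inv_le_iff₀' (Real.exp_pos _)).2 h

theorem ae_eq_zero_of_bargmannIntegral (hf : MemLp f 2) (h : ∀ z, bargmannIntegral f z = 0) :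
    ∀ᵐ t, f t = 0 := by
  have h1 : Integrable fun t : ℝ => f t * Complex.exp (-Real.pi * t ^ 2) := by
    simpa using integrable_bargmann hf 0
  have h2 := ae_eq_zero_of_fourier_eq_zero h1 fun ξ => by
    -- At `z = -iξ` the Bargmann integral is the Fourier transform of `f(t) exp(-πt²)` at `ξ`.
    rw [Real.fourier_real_eq_integral_exp_smul, ← h (-Complex.I * ξ)]
    refine integral_congr_ae (Eventually.of_forall fun t => ?_)
    simp only [smul_eq_mul]
    rw [mul_left_comm, ← Complex.exp_add]
    congr 2
    push_cast
    ring
  filter_upwards [h2] with t ht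
  exact (mul_eq_zero.1 ht).resolve_right (Complex.exp_ne_zero _)

/-- The inner product conjugates its first argument and so reverses the modulation; hence the
evaluation point is `x - iy`, and the conjugation symmetry of the zero set is needed later. -/
theorem inner_gaborSystem {Λ : Set (ℝ × ℝ)} (p : Λ) (f : Lp ℂ 2 (volume : Measure ℝ)) :
    ⟪gaborSystem gaussian memLp_gaussian Λ p, f⟫_ℂ =
      Complex.exp (-Real.pi * (p : ℝ × ℝ).1 ^ 2) *
        bargmannIntegral f ((p : ℝ × ℝ).1 - Complex.I * (p : ℝ × ℝ).2) := by
  rw [L2.inner_def, bargmannIntegral, ← integral_const_mul]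
  refine integral_congr_ae ?_
  filter_upwards [(memLp_shift memLp_gaussian (p : ℝ × ℝ)).coeFn_toLp] with t ht
  rw [gaborSystem, ht, RCLike.inner_apply, mul_left_comm]
  congr 1
  rw [shift, gaussian, map_mul, Complex.conj_ofReal, ← Complex.exp_conj, Complex.ofReal_exp,
    ← Complex.exp_add, ← Complex.exp_add]
  congr 1
  simp only [map_mul, Complex.conj_ofReal, Complex.conj_I, map_ofNat]
  push_cast
  ring

end

theorem sineProduct_conj_eq_zero {z : ℂ} (hz : sineProduct z = 0) :
    sineProduct (starRingEnd ℂ z) = 0 := by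
  rw [sineProduct_eq_zero_iff] at hz ⊢
  refine ⟨by simpa using hz.1, ?_⟩
  rw [← map_pow]
  rcases hz.2 with h | ⟨k, h⟩
  · left; rw [h, map_one]
  · right; exact ⟨k, by rw [h, map_mul, map_ofNat, map_intCast]⟩

theorem isCompleteSystem_gaborSystem_crossSet :
    IsCompleteSystem (gaborSystem gaussian memLp_gaussian crossSet) := by
  rw [IsCompleteSystem, Submodule.topologicalClosure_eq_top_iff, Submodule.eq_bot_iff]
  intro f hf
  have hfm : MemLp f 2 volume := Lp.memLp f
  rw [Lp.eq_zero_iff_ae_eq_zero]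
  refine ae_eq_zero_of_bargmannIntegral hfm (bargmannIntegral_eq_zero hfm fun z hz => ?_)
  have hz' : starRingEnd ℂ z ∈ toComplexSet crossSet := by
    rw [toComplexSet_crossSet]
    exact sineProduct_conj_eq_zero hz
  obtain ⟨p, hp, hpz⟩ := hz'
  have h := (Submodule.mem_orthogonal _ _).1 hf _ (Submodule.subset_span ⟨⟨p, hp⟩, rfl⟩)
  rw [inner_gaborSystem] at h
  have hz2 : z = (p.1 : ℂ) - Complex.I * p.2 := by
    rw [← Complex.conj_conj z, ← hpz]
    simp
    ring
  rw [hz2]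
  exact (mul_eq_zero.1 h).resolve_left (Complex.exp_ne_zero _)

/-! ### Gram matrices and minimality. -/

section Gram

variable {ι H H' : Type*} [NormedAddCommGroup H] [InnerProductSpace ℂ H]
  [NormedAddCommGroup H'] [InnerProductSpace ℂ H'] {v : ι → H} {u : ι → H'} {r : ℝ}

theorem norm_sq_linearCombination_of_inner_eq (h : ∀ i j, ⟪v i, v j⟫_ℂ = r * ⟪u i, u j⟫_ℂ)
    (c : ι →₀ ℂ) : ‖Finsupp.linearCombination ℂ v c‖ ^ 2 =
      r * ‖Finsupp.linearCombination ℂ u c‖ ^ 2 := by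
  have key : ⟪Finsupp.linearCombination ℂ v c, Finsupp.linearCombination ℂ v c⟫_ℂ =
      r * ⟪Finsupp.linearCombination ℂ u c, Finsupp.linearCombination ℂ u c⟫_ℂ := by
    simp only [Finsupp.linearCombination_apply, Finsupp.sum, sum_inner, inner_sum, inner_smul_left,
      inner_smul_right, h, Finset.mul_sum]
    refine Finset.sum_congr rfl fun i _ => Finset.sum_congr rfl fun j _ => ?_
    ring
  rw [inner_self_eq_norm_sq_to_K, inner_self_eq_norm_sq_to_K] at key
  apply Complex.ofReal_injective
  simpa using key

/-- Membership in a closed linear span depends only on the Gram matrix, up to a scalar. -/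
theorem mem_topologicalClosure_span_of_inner_eq (hr : 0 < r)
    (h : ∀ i j, ⟪v i, v j⟫_ℂ = r * ⟪u i, u j⟫_ℂ) {i : ι} {s : Set ι}
    (hi : v i ∈ (Submodule.span ℂ (v '' s)).topologicalClosure) :
    u i ∈ (Submodule.span ℂ (u '' s)).topologicalClosure := by
  rw [← SetLike.mem_coe, Submodule.topologicalClosure_coe, Metric.mem_closure_iff] at hi ⊢
  intro ε hε
  obtain ⟨b, hb, hd⟩ := hi (√r * ε) (by positivity)
  obtain ⟨l, hl, rfl⟩ := (Finsupp.mem_span_image_iff_linearCombination ℂ).1 hb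
  refine ⟨Finsupp.linearCombination ℂ u l,
    (Finsupp.mem_span_image_iff_linearCombination ℂ).2 ⟨l, hl, rfl⟩, ?_⟩
  -- The same coefficients approximate in both spaces, with distances scaled by `√r`.
  have h1 := norm_sq_linearCombination_of_inner_eq h (Finsupp.single i 1 - l)
  simp only [map_sub, Finsupp.linearCombination_single, one_smul] at h1
  rw [dist_eq_norm] at hd ⊢
  have h2 : ‖v i - Finsupp.linearCombination ℂ v l‖ ^ 2 < r * ε ^ 2 := by
    calc _ < (√r * ε) ^ 2 := by gcongr
      _ = _ := by rw [mul_pow, Real.sq_sqrt hr.le]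
  rw [h1] at h2
  exact lt_of_pow_lt_pow_left₀ 2 hε.le (lt_of_mul_lt_mul_left h2 hr.le)

end Gram

theorem MemFock.memLp {F : ℂ → ℂ} (hF : MemFock F) :
    MemLp (fun w : ℂ => F w * (Real.exp (-(Real.pi / 2) * ‖w‖ ^ 2) : ℂ)) 2 := by
  have hc := hF.1.continuous
  rw [memLp_two_iff_integrable_sq_norm (by fun_prop : Continuous _).aestronglyMeasurable]
  refine hF.integrable_sq.congr (Eventually.of_forall fun w => ?_)
  simp only
  rw [norm_mul, Complex.norm_real, Real.norm_of_nonneg (Real.exp_pos _).le]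

/-- A function in the Fock space, as an element of `L²(ℂ)` after multiplication by the weight. -/
noncomputable def MemFock.toLp {F : ℂ → ℂ} (hF : MemFock F) : Lp ℂ 2 (volume : Measure ℂ) :=
  hF.memLp.toLp _

theorem memFock_cexp (z : ℂ) :
    MemFock fun w => Complex.exp (Real.pi * starRingEnd ℂ z * w) := by
  refine ⟨by fun_prop, (((integrable_gaussian_complex Real.pi_pos).comp_sub_right z).const_mul
    (Real.exp (Real.pi * ‖z‖ ^ 2))).congr (Eventually.of_forall fun w => ?_)⟩
  simp only
  rw [Complex.norm_exp, mul_assoc, Complex.re_ofReal_mul, ← Real.exp_nat_mul, ← Real.exp_add,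
    ← Real.exp_add]
  congr 1
  simp only [← Complex.normSq_eq_norm_sq, Complex.normSq_apply, Complex.sub_re, Complex.sub_im,
    Complex.mul_re, Complex.conj_re, Complex.conj_im]
  push_cast
  ring

theorem inner_memFock_cexp {F : ℂ → ℂ} (hF : MemFock F) (z : ℂ) :
    ⟪(memFock_cexp z).toLp, hF.toLp⟫_ℂ = F z := by
  rw [L2.inner_def, ← integral_mul_kernel hF z]
  refine integral_congr_ae ?_
  filter_upwards [(memFock_cexp z).memLp.coeFn_toLp, hF.memLp.coeFn_toLp] with w h1 h2
  rw [MemFock.toLp, MemFock.toLp, h1, h2, RCLike.inner_apply, map_mul, Complex.conj_ofReal,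
    ← Complex.exp_conj, map_mul, map_mul, Complex.conj_conj, Complex.conj_ofReal]
  have h3 : (Real.exp (-Real.pi * ‖w‖ ^ 2) : ℂ) =
      (Real.exp (-(Real.pi / 2) * ‖w‖ ^ 2) : ℂ) * (Real.exp (-(Real.pi / 2) * ‖w‖ ^ 2) : ℂ) := by
    rw [← Complex.ofReal_mul, ← Real.exp_add]
    congr 2
    ring
  rw [h3]
  ring

/-- The element of `L²(ℂ)` corresponding to the time-frequency shift of the Gaussian by `p`. -/
noncomputable def fockKernel (p : ℝ × ℝ) : Lp ℂ 2 (volume : Measure ℂ) :=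
  Complex.exp (-(Real.pi / 2) * (p.1 ^ 2 + p.2 ^ 2) + Real.pi * p.1 * p.2 * Complex.I) •
    (memFock_cexp (p.1 - Complex.I * p.2)).toLp

theorem inner_fockKernel_left {F : ℂ → ℂ} (hF : MemFock F) (p : ℝ × ℝ) :
    ⟪fockKernel p, hF.toLp⟫_ℂ =
      Complex.exp (-(Real.pi / 2) * (p.1 ^ 2 + p.2 ^ 2) - Real.pi * p.1 * p.2 * Complex.I) *
        F (p.1 - Complex.I * p.2) := by
  rw [fockKernel, inner_smul_left, inner_memFock_cexp, ← Complex.exp_conj]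
  congr 2
  simp only [map_add, map_mul, map_neg, map_div₀, map_pow, Complex.conj_ofReal, Complex.conj_I,
    map_ofNat]
  ring

/-- Both sides are explicit Gaussian expressions. The constant is `‖g‖² = 2^(-1/2)`, and the phase
in `fockKernel` is chosen to make the exponents agree. -/
theorem inner_gaborSystem_gaussian {Λ : Set (ℝ × ℝ)} (p q : Λ) :
    ⟪gaborSystem gaussian memLp_gaussian Λ p, gaborSystem gaussian memLp_gaussian Λ q⟫_ℂ =
      (((1 / 2 : ℝ) ^ (1 / 2 : ℝ) : ℝ) : ℂ) *
        ⟪fockKernel (p : ℝ × ℝ), fockKernel (q : ℝ × ℝ)⟫_ℂ := by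
  obtain ⟨⟨x, y⟩, hp⟩ := p
  obtain ⟨⟨x', y'⟩, hq⟩ := q
  have hpi : (Real.pi : ℂ) ≠ 0 := by exact_mod_cast Real.pi_ne_zero
  have h1 : bargmannIntegral (gaborSystem gaussian memLp_gaussian Λ ⟨(x', y'), hq⟩)
      (x - Complex.I * y) = ∫ t : ℝ, Complex.exp (-(2 * Real.pi) * t ^ 2 +
        (2 * Real.pi * (x + x' + Complex.I * (y' - y))) * t + -Real.pi * x' ^ 2) := by
    rw [bargmannIntegral]
    refine integral_congr_ae ?_
    filter_upwards [(memLp_shift memLp_gaussian ((x', y') : ℝ × ℝ)).coeFn_toLp] with t ht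
    rw [gaborSystem, ht, shift, gaussian, Complex.ofReal_exp, ← Complex.exp_add, ← Complex.exp_add]
    congr 1
    push_cast
    ring
  have hb : (-(2 * Real.pi) : ℂ).re < 0 := by simp [Real.pi_pos]
  rw [inner_gaborSystem, h1, integral_cexp_quadratic hb]
  conv_rhs => rw [fockKernel, fockKernel, inner_smul_right, inner_smul_left, inner_memFock_cexp]
  have h2 : (Real.pi / -(-(2 * Real.pi)) : ℂ) ^ (1 / 2 : ℂ) =
      (((1 / 2 : ℝ) ^ (1 / 2 : ℝ) : ℝ) : ℂ) := by
    rw [Complex.ofReal_cpow (by norm_num)]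
    congr 1
    · push_cast
      field_simp
    · push_cast
      rfl
  rw [h2, mul_left_comm]
  congr 1
  rw [← Complex.exp_conj, ← Complex.exp_add, ← Complex.exp_add, ← Complex.exp_add]
  congr 1
  simp only [map_add, map_sub, map_mul, map_neg, map_div₀, map_pow, Complex.conj_ofReal,
    Complex.conj_I, map_ofNat]
  field_simp
  ring_nf
  simp only [Complex.I_sq]
  ring

theorem isMinimalSystem_gaborSystem_crossSet :
    IsMinimalSystem (gaborSystem gaussian memLp_gaussian crossSet) := by
  intro i hi
  have hzero : ∀ p ∈ crossSet, sineProduct ((p.1 : ℂ) - Complex.I * p.2) = 0 := by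
    intro p hp
    have h : (p.1 : ℂ) + Complex.I * p.2 ∈ toComplexSet crossSet := ⟨p, hp, rfl⟩
    rw [toComplexSet_crossSet] at h
    have := sineProduct_conj_eq_zero h
    simpa [sub_eq_add_neg] using this
  have hi0 := hzero i i.2
  have hF := memFock_dslope_sineProduct hi0
  have h1 := mem_topologicalClosure_span_of_inner_eq (u := fun p : crossSet => fockKernel p)
    (by positivity) inner_gaborSystem_gaussian hi
  -- Pairing with a kernel evaluates at its conjugate point, up to a nonzero factor, so `s(z)/(z -
  -- a)` annihilates the closed span of the others. It does not annihilate the kernel of `i`, as the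
  -- zero `a` is simple.
  have h2 : (Submodule.span ℂ ((fun p : crossSet => fockKernel p) ''
      {j | j ≠ i})).topologicalClosure ≤ (Submodule.span ℂ {hF.toLp})ᗮ := by
    refine Submodule.topologicalClosure_minimal _ (Submodule.span_le.2 ?_)
      (Submodule.isClosed_orthogonal _)
    rintro _ ⟨j, hj, rfl⟩
    rw [SetLike.mem_coe, Submodule.mem_orthogonal_singleton_iff_inner_left, inner_fockKernel_left,
      dslope_sineProduct_eq_zero hi0 (hzero j j.2), mul_zero]
    intro hji
    refine hj (Subtype.ext (Prod.ext ?_ ?_))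
    · simpa using congrArg Complex.re hji
    · simpa using congrArg Complex.im hji
  have h3 := Submodule.mem_orthogonal_singleton_iff_inner_left.1 (h2 h1)
  rw [inner_fockKernel_left] at h3
  exact dslope_sineProduct_self_ne_zero hi0
    ((mul_eq_zero.1 h3).resolve_left (Complex.exp_ne_zero _))

end GaborGauss

theorem theorem1 :
    (GaborGauss.IsCompleteSystem
        (GaborGauss.gaborSystem GaborGauss.gaussian GaborGauss.memLp_gaussian
          GaborGauss.crossSet) ∧
      GaborGauss.IsMinimalSystem
        (GaborGauss.gaborSystem GaborGauss.gaussian GaborGauss.memLp_gaussian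
          GaborGauss.crossSet)) ∧
    (Differentiable ℂ GaborGauss.sineProduct ∧
      GaborGauss.toComplexSet GaborGauss.crossSet = {z : ℂ | GaborGauss.sineProduct z = 0}) ∧
    GaborGauss.IsFockUniquenessSetOfZeroExcess
      (GaborGauss.toComplexSet GaborGauss.crossSet) :=
  ⟨⟨GaborGauss.isCompleteSystem_gaborSystem_crossSet,
      GaborGauss.isMinimalSystem_gaborSystem_crossSet⟩,
    ⟨GaborGauss.differentiable_sineProduct, GaborGauss.toComplexSet_crossSet⟩,
    GaborGauss.isFockUniquenessSetOfZeroExcess_crossSet⟩
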